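/- **Setting.** Let $d\ge 1$, let $r,R,c>0$ and $G,M$ be real numbers, and let $\mathcal K\subseteq\mathbb R^d$ be a closed convex set with $r\mathcal B^d\subseteq\mathcal K\subseteq R\mathcal B^d$, where $\mathcal B^d$ is the closed Euclidean unit ball. Let $V=\{1,\dots,n\}$ be the nodes of an undirected graph with edge relation $E$ (self-loops allowed), $N_i=\{j:(i,j)\in E\}$, and let $P\in\mathbb R^{n\times n}$ be non-negative, symmetric and doubly stochastic, with $P_{ij}>0$ only if $(i,j)\in E$, and with second largest singular value $\sigma_2(P)<1$ ($\sigma_2(P)=0$ if $n=1$). Let $T\ge 1$ be such that $\sqrt T$ is an integer. For $t\in\{1,\dots,T\}$ and $i\in V$ let $f_{t,i}$ be real-valued losses, fixed in advance (oblivious adversary), each convex and $G$-Lipschitz on $\mathcal K$ and satisfying $|f_{t,i}|\le M$ on $\mathcal K$. **Parameters.** Let $0<\gamma<1/2$, $$\xi_T=1+\sqrt{8\ln\frac{n\sqrt T}{\gamma}},\quad K=L=\sqrt T,\quad \delta=cT^{-1/4}\le r,\quad h=\frac{n^{1/4}\,\xi_T\,d\,M\,T^{3/4}}{\sqrt{1-\sigma_2(P)}\,R},\quad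 \mathcal K_\delta=(1-\delta/r)\mathcal K .$$ **Algorithm (D-BBCG for convex losses).** Given $\mathbf x_{\rm in}\in\mathcal K_\delta$, put $\mathbf x_i(1)=\mathbf x_{\rm in}$ and $\mathbf z_i(1)=\mathbf 0$ for all $i\in V$. In each block $m=1,\dots,T/K$, every learner $i$ does the following. * In each round $t=(m-1)K+1,\dots,mK$ it plays $\mathbf y_i(t)=\mathbf x_i(m)+\delta\mathbf u_i(t)$, where the $\mathbf u_i(t)$ are independent and uniform on the unit sphere, observes $f_{t,i}(\mathbf y_i(t))$, and sets $\mathbf g_i(t)=\frac d\delta f_{t,i}(\mathbf y_i(t))\,\mathbf u_i(t)$. * It computes $\mathbf x_i(m+1)$ by $L$ conditional gradient steps over $\mathcal K_\delta$ for $F_{m,i}(\mathbf x)=\mathbf z_i(m)^\top\mathbf x+h\|\mathbf x-\mathbf x_{\rm in}\|_2^2$, started at $\mathbf c_0=\mathbf x_i(m)$: for $\tau=0,\dots,L-1$, $\mathbf v_\tau\in\arg\min_{\mathbf x\in\mathcal K_\delta}\nabla F_{m,i}(\mathbf c_\tau)^\top\mathbf x$, $s_\tau\in\arg\min_{s\in[0,1]}F_{m,i}(\mathbf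 c_\tau+s(\mathbf v_\tau-\mathbf c_\tau))$, $\mathbf c_{\tau+1}=\mathbf c_\tau+s_\tau(\mathbf v_\tau-\mathbf c_\tau)$; then $\mathbf x_i(m+1)=\mathbf c_L$. Minimizers may be chosen in any measurable way that depends only on the information available at the end of block $m$. * It sets $\mathbf z_i(m+1)=\sum_{j\in N_i}P_{ij}\mathbf z_j(m)+\sum_{t=(m-1)K+1}^{mK}\mathbf g_i(t)$. **Theorem.** There is a constant $C>0$, depending only on $d,G,M,r,R,c$, such that in every such situation, for every $i\in V$, with probability at least $1-2\gamma$, $$R_{T,i}:=\sum_{t=1}^T\sum_{j=1}^n f_{t,j}(\mathbf y_i(t))-\min_{\mathbf x\in\mathcal K}\sum_{t=1}^T\sum_{j=1}^n f_{t,j}(\mathbf x)\;\le\; C\,n^{5/4}\,(1-\sigma_2(P))^{-1/2}\,T^{3/4}\,\xi_T .$$ -/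

import Mathlib

open MeasureTheory ProbabilityTheory
open scoped Gradient RealInnerProductSpace Pointwise

noncomputable section

/-- The decision space `ℝ^d` with its Euclidean norm. -/
abbrev Euc (d : ℕ) : Type := EuclideanSpace ℝ (Fin d)

/-- The unit sphere of `ℝ^d`. -/
abbrev UnitSphere (d : ℕ) : Type := Metric.sphere (0 : Euc d) 1

/-- The uniform distribution on the unit sphere of `ℝ^d`: normalised surface measure. -/
def uniformSphere (d : ℕ) : Measure (UnitSphere d) :=
  ((volume : Measure (Euc d)).toSphere Set.univ)⁻¹ • (volume : Measure (Euc d)).toSphere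

/-- The second largest singular value of a square matrix (singular values are listed with
multiplicity, in decreasing order, from index `0`; for a `1 × 1` matrix this is `0`). -/
def sigmaTwo {n : ℕ} (P : Matrix (Fin n) (Fin n) ℝ) : ℝ :=
  (Matrix.toEuclideanLin P).singularValues 1

/-- `P` is a weight matrix on the undirected graph with node set `Fin n` and edge relation `E`
(self-loops are allowed): non-negative, symmetric, doubly stochastic, supported on the edges,
with second largest singular value smaller than one. -/
structure IsGossipMatrix {n : ℕ} (E : Fin n → Fin n → Prop) (P : Matrix (Fin n) (Fin n) ℝ) :
    Prop where
  doublyStochastic : P ∈ doublyStochastic ℝ (Fin n)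
  isSymm : P.IsSymm
  support : ∀ i j, 0 < P i j → E i j
  sigmaTwo_lt_one : sigmaTwo P < 1

open Classical in
/-- The set `N_i` of neighbours of node `i`. -/
def neighbors {n : ℕ} (E : Fin n → Fin n → Prop) (i : Fin n) : Finset (Fin n) :=
  Finset.univ.filter (fun j => E i j)

/-- The shrunk feasible set `(1 - δ / r) 𝒦`. -/
def shrink {d : ℕ} (𝒦 : Set (Euc d)) (r δ : ℝ) : Set (Euc d) := (1 - δ / r) • 𝒦

/-- The rounds `(m - 1) K + 1, …, m K` of block `m ≥ 1`. -/
def blockRounds (K m : ℕ) : Finset ℕ := Finset.Icc ((m - 1) * K + 1) (m * K)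

/-- The surrogate loss `x ↦ ⟪z, x⟫ + ((m - 1) α K / 2) ‖x‖² + h ‖x - x_in‖²` of block `m`. -/
def surrogate {d : ℕ} (α h : ℝ) (K m : ℕ) (xin z : Euc d) (x : Euc d) : ℝ :=
  ⟪z, x⟫ + ((m : ℝ) - 1) * α * K / 2 * ‖x‖ ^ 2 + h * ‖x - xin‖ ^ 2

/-- `c 0, …, c L` are the iterates of the conditional gradient method with `L` iterations for `F`
over `S`, started at `x₀` and returning `xout`. Here `v τ` is a solution of the `τ`-th linear
optimization problem (any minimizer may be taken) and `s τ` is the step size found by line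
search. -/
structure IsCGRun {d : ℕ} (S : Set (Euc d)) (L : ℕ) (F : Euc d → ℝ) (x₀ : Euc d)
    (c v : ℕ → Euc d) (s : ℕ → ℝ) (xout : Euc d) : Prop where
  init : c 0 = x₀
  lin_mem : ∀ τ < L, v τ ∈ S
  lin_min : ∀ τ < L, IsMinOn (fun x => ⟪∇ F (c τ), x⟫) S (v τ)
  step_mem : ∀ τ < L, s τ ∈ Set.Icc (0 : ℝ) 1
  step_min : ∀ τ < L, IsMinOn (fun q : ℝ => F (c τ + q • (v τ - c τ))) (Set.Icc (0 : ℝ) 1) (s τ)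
  next : ∀ τ < L, c (τ + 1) = c τ + s τ • (v τ - c τ)
  output : c L = xout

/-- A run, over `T / K` blocks of `K` rounds, of distributed block bandit conditional gradient
(D-BBCG), when learner `i` uses the random direction `u t i` in round `t`. Blocks `m` and rounds
`t` are numbered from one. The fields are all the quantities computed by the algorithm, as functions
of the random outcome `ω`, and the equations that define them; the only freedom is in the choice
of minimizers inside the conditional gradient method. -/
structure DBBCGRun {n d : ℕ} {Ω : Type*} (E : Fin n → Fin n → Prop)
    (P : Matrix (Fin n) (Fin n) ℝ) (f : ℕ → Fin n → Euc d → ℝ) (𝒦 : Set (Euc d)) (r δ : ℝ)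
    (xin : Euc d) (α h : ℝ) (L K T : ℕ) (u : ℕ → Fin n → Ω → UnitSphere d) where
  /-- `x m i` is the point held by learner `i` during block `m`. -/
  x : ℕ → Fin n → Ω → Euc d
  /-- `z m i` is the dual variable of learner `i` in block `m`. -/
  z : ℕ → Fin n → Ω → Euc d
  /-- `y t i` is the decision played by learner `i` in round `t`. -/
  y : ℕ → Fin n → Ω → Euc d
  /-- `g t i` is the one-point gradient estimate of learner `i` in round `t`. -/
  g : ℕ → Fin n → Ω → Euc d
  /-- `gHat m i` is the cumulative gradient estimate of learner `i` in block `m`. -/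
  gHat : ℕ → Fin n → Ω → Euc d
  /-- `c m i τ` is the `τ`-th conditional gradient iterate of learner `i` in block `m`. -/
  c : ℕ → Fin n → ℕ → Ω → Euc d
  /-- `v m i τ` is the corresponding solution of the linear optimization problem. -/
  v : ℕ → Fin n → ℕ → Ω → Euc d
  /-- `s m i τ` is the corresponding step size. -/
  s : ℕ → Fin n → ℕ → Ω → ℝ
  x_one : ∀ i ω, x 1 i ω = xin
  z_one : ∀ i ω, z 1 i ω = 0
  y_eq : ∀ m ∈ Finset.Icc 1 (T / K), ∀ t ∈ blockRounds K m, ∀ i ω,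
    y t i ω = x m i ω + δ • (u t i ω : Euc d)
  g_eq : ∀ t ∈ Finset.Icc 1 T, ∀ i ω,
    g t i ω = ((d : ℝ) / δ * f t i (y t i ω)) • (u t i ω : Euc d)
  gHat_eq : ∀ m ∈ Finset.Icc 1 (T / K), ∀ i ω, gHat m i ω = ∑ t ∈ blockRounds K m, g t i ω
  x_succ : ∀ m ∈ Finset.Icc 1 (T / K), ∀ i ω,
    IsCGRun (shrink 𝒦 r δ) L (surrogate α h K m xin (z m i ω)) (x m i ω)
      (fun τ => c m i τ ω) (fun τ => v m i τ ω) (fun τ => s m i τ ω) (x (m + 1) i ω)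
  z_succ : ∀ m ∈ Finset.Icc 1 (T / K), ∀ i ω,
    z (m + 1) i ω = ∑ j ∈ neighbors E i, P i j • z m j ω + gHat m i ω - (α * K) • x m i ω

/-- The minimizers chosen in block `m` are random variables which depend only on what is known
at the end of this block, that is, after round `m K`; `ℱ t` is the information available after
round `t`. -/
def DBBCGRun.IsCausal {n d : ℕ} {Ω : Type*} [mΩ : MeasurableSpace Ω] {E : Fin n → Fin n → Prop}
    {P : Matrix (Fin n) (Fin n) ℝ} {f : ℕ → Fin n → Euc d → ℝ} {𝒦 : Set (Euc d)} {r δ : ℝ}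
    {xin : Euc d} {α h : ℝ} {L K T : ℕ} {u : ℕ → Fin n → Ω → UnitSphere d}
    (A : DBBCGRun E P f 𝒦 r δ xin α h L K T u) (ℱ : Filtration ℕ mΩ) : Prop :=
  ∀ m ∈ Finset.Icc 1 (T / K), ∀ i, ∀ τ < L,
    Measurable[ℱ (m * K)] (A.v m i τ) ∧ Measurable[ℱ (m * K)] (A.s m i τ)

/-- The directions `u t i` (rounds `1 ≤ t ≤ T`, learners `i`) are independent and uniformly
distributed on the unit sphere; `u t i` is known after round `t`, and the directions of a round
are independent of everything known after the previous rounds. -/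
structure IsUniformSampling {n d : ℕ} {Ω : Type*} [mΩ : MeasurableSpace Ω] (μ : Measure Ω)
    (ℱ : Filtration ℕ mΩ) (T : ℕ) (u : ℕ → Fin n → Ω → UnitSphere d) : Prop where
  adapted : ∀ t ∈ Finset.Icc 1 T, ∀ i, Measurable[ℱ t] (u t i)
  uniform : ∀ t ∈ Finset.Icc 1 T, ∀ i, HasLaw (u t i) (uniformSphere d) μ
  indep_learners : ∀ t ∈ Finset.Icc 1 T, iIndepFun (u t) μ
  indep_past : ∀ t < T,
    Indep (MeasurableSpace.comap (fun ω i => u (t + 1) i ω) inferInstance) (ℱ t) μ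

/-- The regret after `T` rounds, measured by the global loss `∑ j, f t j`, of a learner that
plays `y 1, …, y T`. -/
def regret {n d : ℕ} (f : ℕ → Fin n → Euc d → ℝ) (𝒦 : Set (Euc d)) (T : ℕ) (y : ℕ → Euc d) : ℝ :=
  ∑ t ∈ Finset.Icc 1 T, ∑ j, f t j (y t)
    - sInf ((fun x => ∑ t ∈ Finset.Icc 1 T, ∑ j, f t j x) '' 𝒦)

/-- The factor `ξ_T = 1 + √(8 ln (n √T / γ))`. -/
def xi (n T : ℕ) (γ : ℝ) : ℝ := 1 + √(8 * Real.log (n * √(T : ℝ) / γ))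

end

noncomputable section

open Filter Topology Set

/-! Write `K = √T`, so there are `K` blocks of `K` rounds and `δ = c / √K`. On two events, each
failing with probability at most `γ`, the regret bound is deterministic.

The mean of the one-point estimate is the gradient of the average of the loss over a ball of radius
`δ`. This is the boundary formula `tendsto_slope_integral_ball`, proved for continuous integrands.
For a convex Lipschitz loss the mean is therefore a subgradient up to `2 G δ`
(`sub_le_inner_gradMean`), and its norm is at most `d G` (`norm_gradMean_le`).

A single estimate may have norm `d M / δ`, of order `√K`. The point is frozen within a block and the
noise is centred, so by Azuma–Hoeffding (`measure_sum_ge_le_exp`) the noise of a block is of order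
`√K · √K = K` up to `ξ`, not `K^{3/2}`. Hence the first event: every block gradient has norm at most
`β`, of order `ξ K` (`measure_exists_gHat_gt_le`). The second event bounds the total noise tested
against the distance to the comparator (`measure_exists_noise_gt_le`). The losses are fixed in
advance, so the comparator is deterministic and no union over comparators is needed.

On these events every learner follows one virtual leader, the regularised minimizer for the sum of
the averaged block gradients, the current block included. The distance `D` to it has three sources:
inexact minimization, `4 R / √K` (`IsProx.norm_cg_sub_le`); disagreement of the dual variables, `√n
β / (1 - σ₂)`, from the spectral gap (`IsGossipMatrix.norm_sub_nodeMean_le`); and a lag of two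
blocks, `2 β`. The last two are divided by `2 h`, because the minimizer is `1 / (2 h)`-Lipschitz in
the dual variable. The leader itself pays at most `4 h R²` (`IsProx.sum_inner_le`).

Per node, the regret is thus of order `K² (D + δ) + K β D + h R²` plus noise
(`DBBCGRun.regret_le_of_bounds`). With `θ = n^{1/4} / √(1 - σ₂)` and `h` proportional to `θ ξ
K^{3/2}`, `D` is of order `θ / √K` and every term is at most of order `θ ξ K^{3/2}`
(`regret_bound_arith`). -/

/-! ### Polar coordinates and the integral over a moving ball -/

/-- Integration in polar coordinates. -/
theorem integral_polar {d : ℕ} (hd : 0 < d) (φ : Euc d → ℝ) (hφ : Integrable φ) :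
    Integrable (fun u : UnitSphere d => ∫ s in Ioi (0 : ℝ), s ^ (d - 1) * φ (s • (u : Euc d)))
      (volume : Measure (Euc d)).toSphere ∧
    ∫ x, φ x = ∫ u : UnitSphere d, (∫ s in Ioi (0 : ℝ), s ^ (d - 1) * φ (s • (u : Euc d)))
      ∂(volume : Measure (Euc d)).toSphere := by
  have : Nonempty (Fin d) := ⟨⟨0, hd⟩⟩
  have hmp := (volume : Measure (Euc d)).measurePreserving_homeomorphUnitSphereProd
  have hfin : Module.finrank ℝ (Euc d) = d := by simp
  rw [hfin] at hmp
  set ψ : UnitSphere d × Ioi (0 : ℝ) → ℝ := fun p => φ ((p.2 : ℝ) • (p.1 : Euc d)) with hψ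
  have hcomp : ∀ x : ({(0 : Euc d)}ᶜ : Set (Euc d)), ψ (homeomorphUnitSphereProd (Euc d) x) = φ x := by
    intro x
    simp only [hψ]
    congr 1
    have := congrArg Subtype.val ((homeomorphUnitSphereProd (Euc d)).symm_apply_apply x)
    rw [← this]
    rw [homeomorphUnitSphereProd_symm_apply_coe]
  have hin : Integrable ψ ((volume : Measure (Euc d)).toSphere.prod
      (Measure.volumeIoiPow (d - 1))) := by
    rw [← hmp.integrable_comp_emb (Homeomorph.measurableEmbedding _)]
    have : (ψ ∘ homeomorphUnitSphereProd (Euc d)) = φ ∘ Subtype.val := by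
      ext x; exact hcomp x
    rw [this, ← integrableOn_iff_comap_subtypeVal (measurableSet_singleton _).compl]
    exact hφ.integrableOn
  have key : ∀ u : UnitSphere d, ∫ s, ψ (u, s) ∂(Measure.volumeIoiPow (d - 1)) =
      ∫ s in Ioi (0 : ℝ), s ^ (d - 1) * φ (s • (u : Euc d)) := by
    intro u
    rw [Measure.volumeIoiPow, integral_withDensity_eq_integral_toReal_smul (by fun_prop) (by simp)]
    rw [← integral_subtype_comap measurableSet_Ioi (fun s : ℝ => s ^ (d - 1) * φ (s • (u : Euc d)))]
    refine integral_congr_ae (Eventually.of_forall fun s => ?_)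
    simp only [hψ, smul_eq_mul]
    rw [ENNReal.toReal_ofReal (pow_nonneg (le_of_lt s.2) _)]
  constructor
  · have := hin.integral_prod_left
    simpa only [key] using this
  · have h1 : ∫ x, φ x = ∫ x : ({(0 : Euc d)}ᶜ : Set (Euc d)), φ x.1
        ∂((volume : Measure (Euc d)).comap (↑)) := by
      rw [integral_subtype_comap (measurableSet_singleton _).compl fun x => φ x,
        restrict_compl_singleton]
    rw [h1]
    simp_rw [← hcomp]
    rw [hmp.integral_comp (Homeomorph.measurableEmbedding _) ψ, integral_prod _ hin]
    simp_rw [key]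

/-- The distance from the origin to the sphere of radius one about `t w`, in the direction of a
unit vector which has inner product `p` with `w`. -/
def exitRadius (W p t : ℝ) : ℝ := t * p + √(1 - t ^ 2 * (W ^ 2 - p ^ 2))

theorem exitRadius_zero (W p : ℝ) : exitRadius W p 0 = 1 := by simp [exitRadius]

/-- The square root varies only to second order in `t`, so the linear term alone contributes. -/
theorem hasDerivAt_exitRadius (W p : ℝ) : HasDerivAt (exitRadius W p) p 0 := by
  have h1 : HasDerivAt (fun t : ℝ => 1 - t ^ 2 * (W ^ 2 - p ^ 2)) 0 0 := by
    have := (((hasDerivAt_id (0 : ℝ)).pow 2).mul_const (W ^ 2 - p ^ 2)).const_sub 1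
    simpa using this
  have h2 := h1.sqrt (by simp)
  have h3 := ((hasDerivAt_id (0 : ℝ)).mul_const p).add h2
  simp only [ne_eq, OfNat.ofNat_ne_zero, not_false_eq_true, zero_pow, zero_mul, sub_zero,
    Real.sqrt_one, mul_one, zero_div, add_zero, one_mul] at h3
  exact h3

theorem abs_exitRadius_sub_one_le {W p t : ℝ} (hW : 0 ≤ W) (hp : |p| ≤ W) (ht : 0 ≤ t)
    (htW : t * W ≤ 1) : |exitRadius W p t - 1| ≤ 2 * (t * W) := by
  have hp2 : p ^ 2 ≤ W ^ 2 := sq_le_sq' (abs_le.1 hp).1 (abs_le.1 hp).2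
  have hx0 : 0 ≤ t ^ 2 * (W ^ 2 - p ^ 2) := mul_nonneg (sq_nonneg t) (by linarith)
  have htW0 : 0 ≤ t * W := mul_nonneg ht hW
  have hx1 : t ^ 2 * (W ^ 2 - p ^ 2) ≤ t * W := by nlinarith [sq_nonneg (t * p)]
  set x := t ^ 2 * (W ^ 2 - p ^ 2)
  have hs1 : √(1 - x) ≤ 1 := Real.sqrt_le_one.2 (by linarith)
  have hs2 : 1 - x ≤ √(1 - x) := Real.le_sqrt_of_sq_le (by nlinarith)
  have htp : |t * p| ≤ t * W := by
    rw [abs_mul, abs_of_nonneg ht]; exact mul_le_mul_of_nonneg_left hp ht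
  rw [abs_le] at htp ⊢
  unfold exitRadius
  constructor <;> linarith [htp.1, htp.2]

/-- The origin is inside the shifted ball, so the quadratic in `s` has one negative and one positive
root and a ray leaves the ball exactly once. -/
theorem mem_ball_iff_lt_exitRadius {d : ℕ} {u w : Euc d} (hu : ‖u‖ = 1) {t s : ℝ} (ht : 0 ≤ t)
    (htw : t * ‖w‖ < 1) (hs : 0 < s) :
    s • u ∈ Metric.ball (t • w) 1 ↔ s < exitRadius ‖w‖ ⟪u, w⟫ t := by
  have hp : |⟪u, w⟫| ≤ ‖w‖ := by
    have := abs_real_inner_le_norm u w; rwa [hu, one_mul] at this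
  have hp2 : ⟪u, w⟫ ^ 2 ≤ ‖w‖ ^ 2 := sq_le_sq' (abs_le.1 hp).1 (abs_le.1 hp).2
  have hx1 : t ^ 2 * (‖w‖ ^ 2 - ⟪u, w⟫ ^ 2) < 1 := by
    nlinarith [sq_nonneg (t * ⟪u, w⟫), mul_nonneg ht (norm_nonneg w)]
  have hx2 : t ^ 2 * (‖w‖ ^ 2) < 1 := by
    nlinarith [mul_nonneg ht (norm_nonneg w)]
  have hnorm : ‖s • u - t • w‖ ^ 2 = (s - t * ⟪u, w⟫) ^ 2 + t ^ 2 * (‖w‖ ^ 2 - ⟪u, w⟫ ^ 2) := by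
    rw [norm_sub_sq_real, norm_smul, norm_smul, hu, inner_smul_left, inner_smul_right]
    simp only [Real.norm_eq_abs, mul_pow, sq_abs, conj_trivial]
    ring
  rw [mem_ball_iff_norm]
  have hsq : ‖s • u - t • w‖ < 1 ↔ ‖s • u - t • w‖ ^ 2 < 1 := by
    rw [sq_lt_one_iff₀ (norm_nonneg _)]
  rw [hsq, hnorm]
  unfold exitRadius
  set p := ⟪u, w⟫
  set y := 1 - t ^ 2 * (‖w‖ ^ 2 - p ^ 2) with hy
  have hy0 : 0 < y := by linarith
  have hroot : |t * p| < √y := by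
    rw [Real.lt_sqrt (abs_nonneg _), sq_abs, hy]
    nlinarith
  have e : (s - t * p) ^ 2 + t ^ 2 * (‖w‖ ^ 2 - p ^ 2) < 1 ↔ (s - t * p) ^ 2 < y := by
    constructor <;> intro h <;> linarith
  rw [e, Real.sq_lt]
  have := abs_lt.1 hroot
  constructor
  · intro h; linarith [h.2]
  · intro h; constructor <;> linarith [this.1, this.2]

theorem exitRadius_nonneg {W p t : ℝ} (hW : 0 ≤ W) (hp : |p| ≤ W) (ht : 0 ≤ t)
    (htW : t * W ≤ 1 / 2) : 0 ≤ exitRadius W p t ∧ exitRadius W p t ≤ 2 := by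
  have := abs_le.1 (abs_exitRadius_sub_one_le hW hp ht (by linarith))
  constructor <;> linarith [this.1, this.2]

theorem integral_ray_ball {d : ℕ} {g : Euc d → ℝ} {u w : Euc d} (hu : ‖u‖ = 1)
    {t : ℝ} (ht : 0 ≤ t) (htw : t * ‖w‖ ≤ 1 / 2) :
    ∫ s in Ioi (0 : ℝ), s ^ (d - 1) * (Metric.ball (t • w) 1).indicator g (s • u) =
      ∫ s in (0 : ℝ)..exitRadius ‖w‖ ⟪u, w⟫ t, s ^ (d - 1) * g (s • u) := by
  have hp : |⟪u, w⟫| ≤ ‖w‖ := by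
    have := abs_real_inner_le_norm u w; rwa [hu, one_mul] at this
  obtain ⟨h0, -⟩ := exitRadius_nonneg (norm_nonneg w) hp ht htw
  rw [intervalIntegral.integral_of_le h0, integral_Ioc_eq_integral_Ioo]
  have : Ioo 0 (exitRadius ‖w‖ ⟪u, w⟫ t) = Ioi 0 ∩ Iio (exitRadius ‖w‖ ⟪u, w⟫ t) := by
    ext; simp
  rw [this, ← setIntegral_indicator measurableSet_Iio]
  refine setIntegral_congr_fun measurableSet_Ioi fun s hs => ?_
  have hiff := mem_ball_iff_lt_exitRadius hu ht (by linarith : t * ‖w‖ < 1) hs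
  by_cases h : s < exitRadius ‖w‖ ⟪u, w⟫ t
  · simp only [indicator_of_mem (hiff.2 h), indicator_of_mem (show s ∈ Iio _ from h)]
  · simp only [indicator_of_notMem (fun h' => h (hiff.1 h')), mul_zero,
      indicator_of_notMem (show s ∉ Iio _ from h)]

/-- The directional derivative of the integral of a continuous function over a moving unit ball is
a surface integral. -/
theorem tendsto_slope_integral_ball {d : ℕ} (hd : 0 < d) {g : Euc d → ℝ} (hg : Continuous g)
    (w : Euc d) :
    Tendsto (fun t : ℝ => t⁻¹ * ((∫ v in Metric.ball (0 : Euc d) 1, g (v + t • w)) -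
        ∫ v in Metric.ball (0 : Euc d) 1, g v)) (𝓝[>] 0)
      (𝓝 (∫ s : UnitSphere d, g s * ⟪(s : Euc d), w⟫ ∂(volume : Measure (Euc d)).toSphere)) := by
  obtain ⟨B, hB⟩ : ∃ B, ∀ x ∈ Metric.closedBall (0 : Euc d) 2, ‖g x‖ ≤ B :=
    (isCompact_closedBall (0 : Euc d) 2).exists_bound_of_continuousOn hg.continuousOn
  have hB0 : 0 ≤ B := (norm_nonneg _).trans (hB 0 (by simp))
  -- A translation moves the shift from the integrand to the domain, so no derivative of `g` is
  -- needed.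
  set φ : ℝ → Euc d → ℝ := fun t => (Metric.ball (t • w) 1).indicator g
  have hφ : ∀ t, Integrable (φ t) := fun t =>
    (integrable_indicator_iff Metric.isOpen_ball.measurableSet).2
      ((hg.continuousOn.integrableOn_compact (isCompact_closedBall (t • w) 1)).mono_set
        Metric.ball_subset_closedBall)
  have hshift : ∀ t : ℝ, ∫ v in Metric.ball (0 : Euc d) 1, g (v + t • w) = ∫ x, φ t x := by
    intro t
    rw [← integral_indicator Metric.isOpen_ball.measurableSet,
      ← integral_add_right_eq_self (φ t) (t • w)]
    refine integral_congr_ae (Eventually.of_forall fun v => ?_)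
    by_cases hv : v ∈ Metric.ball (0 : Euc d) 1
    · have : v + t • w ∈ Metric.ball (t • w) 1 := by simpa using hv
      simp only [φ, indicator_of_mem hv, indicator_of_mem this]
    · have : v + t • w ∉ Metric.ball (t • w) 1 := by simpa using hv
      simp only [φ, indicator_of_notMem hv, indicator_of_notMem this]
  set I : ℝ → UnitSphere d → ℝ := fun t u =>
    ∫ s in Ioi (0 : ℝ), s ^ (d - 1) * φ t (s • (u : Euc d)) with hI
  have hII : ∀ t, Integrable (I t) (volume : Measure (Euc d)).toSphere := fun t =>
    (integral_polar hd _ (hφ t)).1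
  have hfun : ∀ t : ℝ, t⁻¹ * ((∫ v in Metric.ball (0 : Euc d) 1, g (v + t • w)) -
        ∫ v in Metric.ball (0 : Euc d) 1, g v) =
      ∫ u, t⁻¹ * (I t u - I 0 u) ∂(volume : Measure (Euc d)).toSphere := by
    intro t
    have h0 := hshift 0
    simp only [zero_smul, add_zero] at h0
    rw [hshift, h0, (integral_polar hd _ (hφ t)).2, (integral_polar hd _ (hφ 0)).2,
      integral_const_mul, integral_sub (hII t) (hII 0)]
  simp_rw [hfun]
  have hunit : ∀ u : UnitSphere d, ‖(u : Euc d)‖ = 1 := fun u => by simp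
  have hray : ∀ (u : UnitSphere d), Continuous (fun s : ℝ => s ^ (d - 1) * g (s • (u : Euc d))) := by
    intro u; fun_prop
  -- On each ray only the piece between the two spheres survives.
  have hdiff : ∀ (u : UnitSphere d) (t : ℝ), 0 ≤ t → t * ‖w‖ ≤ 1 / 2 → I t u - I 0 u =
      ∫ s in (1 : ℝ)..exitRadius ‖w‖ ⟪(u : Euc d), w⟫ t, s ^ (d - 1) * g (s • (u : Euc d)) := by
    intro u t ht htw
    simp only [hI, φ]
    rw [integral_ray_ball (hunit u) ht htw, integral_ray_ball (hunit u) le_rfl (by simp),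
      exitRadius_zero, intervalIntegral.integral_interval_sub_left
        ((hray u).intervalIntegrable _ _) ((hray u).intervalIntegrable _ _)]
  have hpW : ∀ u : UnitSphere d, |⟪(u : Euc d), w⟫| ≤ ‖w‖ := by
    intro u
    have := abs_real_inner_le_norm (u : Euc d) w; rwa [hunit u, one_mul] at this
  have hsmall : ∀ᶠ t : ℝ in 𝓝[>] 0, 0 < t ∧ t * ‖w‖ ≤ 1 / 2 := by
    refine (eventually_mem_nhdsWithin).and (nhdsWithin_le_nhds ?_)
    have : Tendsto (fun t : ℝ => t * ‖w‖) (𝓝 0) (𝓝 (0 * ‖w‖)) :=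
      (continuous_id.mul continuous_const).tendsto 0
    rw [zero_mul] at this
    exact (this.eventually (ge_mem_nhds (by norm_num : (0:ℝ) < 1 / 2)))
  -- The dominating constant: on the surviving piece `s ≤ 2` and `|g| ≤ B`, and its length is at
  -- most `2 t ‖w‖`.
  refine tendsto_integral_filter_of_dominated_convergence
    (fun _ => 2 ^ (d - 1) * B * (2 * ‖w‖)) ?_ ?_ (integrable_const _) ?_
  · exact Eventually.of_forall fun t =>
      (((hII t).sub (hII 0)).const_mul t⁻¹).aestronglyMeasurable
  · filter_upwards [hsmall] with t ht
    refine Eventually.of_forall fun u => ?_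
    rw [hdiff u t ht.1.le ht.2, norm_mul, norm_inv, Real.norm_eq_abs t, abs_of_pos ht.1]
    have hρ := exitRadius_nonneg (norm_nonneg w) (hpW u) ht.1.le ht.2
    have hb := intervalIntegral.norm_integral_le_of_norm_le_const (C := 2 ^ (d - 1) * B)
      (a := 1) (b := exitRadius ‖w‖ ⟪(u : Euc d), w⟫ t)
      (f := fun s => s ^ (d - 1) * g (s • (u : Euc d))) (by
        intro s hs
        have hs2 : 0 ≤ s ∧ s ≤ 2 := by
          rcases uIoc_subset_uIcc hs with ⟨h1, h2⟩
          refine ⟨le_trans (le_min zero_le_one hρ.1) h1, h2.trans (max_le one_le_two hρ.2)⟩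
        rw [norm_mul, norm_pow, Real.norm_eq_abs s, abs_of_nonneg hs2.1]
        refine mul_le_mul (pow_le_pow_left₀ hs2.1 hs2.2 _) (hB _ ?_) (norm_nonneg _) (by positivity)
        rw [mem_closedBall_zero_iff, norm_smul, hunit u, mul_one, Real.norm_eq_abs,
          abs_of_nonneg hs2.1]
        exact hs2.2)
    have hb2 := abs_exitRadius_sub_one_le (norm_nonneg w) (hpW u) ht.1.le
      (by linarith [ht.2] : t * ‖w‖ ≤ 1)
    have hC : 0 ≤ 2 ^ (d - 1) * B := by positivity
    calc t⁻¹ * _ ≤ t⁻¹ * (2 ^ (d - 1) * B * (2 * (t * ‖w‖))) :=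
          mul_le_mul_of_nonneg_left (hb.trans (mul_le_mul_of_nonneg_left hb2 hC))
            (inv_nonneg.2 ht.1.le)
      _ = 2 ^ (d - 1) * B * (2 * ‖w‖) := by
          have := ht.1.ne'
          field_simp
  · refine Eventually.of_forall fun u => ?_
    set p := ⟪(u : Euc d), w⟫
    have hJ : HasDerivAt (fun a : ℝ => ∫ s in (1 : ℝ)..a, s ^ (d - 1) * g (s • (u : Euc d)))
        (g u) (exitRadius ‖w‖ p 0) := by
      have := (hray u).integral_hasStrictDerivAt 1 1
      rw [exitRadius_zero]
      simpa using this.hasDerivAt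
    have hcomp := hJ.comp 0 (hasDerivAt_exitRadius ‖w‖ p)
    rw [hasDerivAt_iff_tendsto_slope] at hcomp
    have hcomp' := hcomp.mono_left (nhdsWithin_mono 0 (fun x (hx : 0 < x) => hx.ne'))
    refine hcomp'.congr' ?_
    filter_upwards [hsmall] with t ht
    rw [hdiff u t ht.1.le ht.2, slope_def_field]
    simp only [Function.comp, exitRadius_zero, intervalIntegral.integral_same, sub_zero]
    rw [div_eq_inv_mul]

/-! ### The uniform law on the sphere and the one-point gradient estimate -/

theorem toSphere_real_univ_euc (d : ℕ) : ((volume : Measure (Euc d)).toSphere).real univ =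
    d * (volume : Measure (Euc d)).real (Metric.ball 0 1) := by
  simp

theorem volume_unitBall_pos (d : ℕ) : 0 < (volume : Measure (Euc d)).real (Metric.ball 0 1) :=
  ENNReal.toReal_pos (Metric.isOpen_ball.measure_pos _ ⟨0, by simp⟩).ne' measure_ball_lt_top.ne

theorem isProbabilityMeasure_uniformSphere {d : ℕ} (hd : 0 < d) :
    IsProbabilityMeasure (uniformSphere d) := by
  have : Nonempty (Fin d) := ⟨⟨0, hd⟩⟩
  constructor
  rw [uniformSphere, Measure.smul_apply, smul_eq_mul]
  refine ENNReal.inv_mul_cancel ?_ (measure_ne_top _ _)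
  rw [Ne, Measure.measure_univ_eq_zero]
  exact Measure.toSphere_ne_zero _

theorem integral_uniformSphere {d : ℕ} {X : Type*} [NormedAddCommGroup X] [NormedSpace ℝ X]
    (φ : UnitSphere d → X) :
    ∫ s, φ s ∂uniformSphere d = (d * (volume : Measure (Euc d)).real (Metric.ball 0 1))⁻¹ •
      ∫ s, φ s ∂(volume : Measure (Euc d)).toSphere := by
  rw [uniformSphere, integral_smul_measure, ENNReal.toReal_inv, ← toSphere_real_univ_euc]
  rfl

theorem norm_coe_unitSphere {d : ℕ} (s : UnitSphere d) : ‖(s : Euc d)‖ = 1 := by simp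

/-- A moving ball keeps its volume: this is the boundary formula for a constant integrand. -/
theorem integral_inner_uniformSphere {d : ℕ} (hd : 0 < d) (w : Euc d) :
    ∫ s : UnitSphere d, ⟪(s : Euc d), w⟫ ∂uniformSphere d = 0 := by
  have h := tendsto_slope_integral_ball hd (g := fun _ => (1 : ℝ)) continuous_const w
  simp only [sub_self, mul_zero, one_mul] at h
  rw [integral_uniformSphere, tendsto_nhds_unique h tendsto_const_nhds, smul_zero]

/-- The one-point gradient estimate at `x` in direction `s`. -/
def gradEstimate {d : ℕ} (F : Euc d → ℝ) (δ : ℝ) (x : Euc d) (s : UnitSphere d) : Euc d :=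
  ((d : ℝ) / δ * F (x + δ • (s : Euc d))) • (s : Euc d)

/-- The expectation of the one-point gradient estimate at `x`. -/
def gradMean {d : ℕ} (F : Euc d → ℝ) (δ : ℝ) (x : Euc d) : Euc d :=
  ∫ s, gradEstimate F δ x s ∂uniformSphere d

theorem continuous_gradEstimate {d : ℕ} {F : Euc d → ℝ} (hF : Continuous F) (δ : ℝ) :
    Continuous (fun p : Euc d × UnitSphere d => gradEstimate F δ p.1 p.2) := by
  unfold gradEstimate; fun_prop

theorem Continuous.integrable_uniformSphere {d : ℕ} (hd : 0 < d) {X : Type*}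
    [NormedAddCommGroup X] [SecondCountableTopology X] {φ : UnitSphere d → X}
    (hφ : Continuous φ) : Integrable φ (uniformSphere d) := by
  have := isProbabilityMeasure_uniformSphere hd
  have : CompactSpace (UnitSphere d) := isCompact_iff_compactSpace.1 (isCompact_sphere _ _)
  borelize X
  obtain ⟨C, hC⟩ := (isCompact_univ (X := UnitSphere d)).exists_bound_of_continuousOn hφ.continuousOn
  exact Integrable.of_bound hφ.measurable.aestronglyMeasurable C
    (Eventually.of_forall fun s => hC s (mem_univ s))

theorem integrable_gradEstimate {d : ℕ} (hd : 0 < d) {F : Euc d → ℝ} (hF : Continuous F) (δ : ℝ)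
    (x : Euc d) : Integrable (gradEstimate F δ x) (uniformSphere d) :=
  Continuous.integrable_uniformSphere hd
    ((continuous_gradEstimate hF δ).comp (by fun_prop : Continuous fun s => (x, s)))

theorem inner_gradMean {d : ℕ} (hd : 0 < d) {F : Euc d → ℝ} (hF : Continuous F) (δ : ℝ)
    (x w : Euc d) : ⟪gradMean F δ x, w⟫ = ∫ s, ⟪gradEstimate F δ x s, w⟫ ∂uniformSphere d := by
  rw [real_inner_comm, gradMean, ← integral_inner (integrable_gradEstimate hd hF δ x)]
  simp_rw [real_inner_comm]

theorem measurable_gradMean {d : ℕ} (hd : 0 < d) {F : Euc d → ℝ} (hF : Continuous F) (δ : ℝ) :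
    Measurable (gradMean F δ) := by
  have := isProbabilityMeasure_uniformSphere hd
  exact ((continuous_gradEstimate hF δ).measurable.stronglyMeasurable.integral_prod_right'
    (ν := uniformSphere d)).measurable

theorem norm_gradEstimate_le {d : ℕ} {F : Euc d → ℝ} {δ M : ℝ} (hδ : 0 < δ) {x : Euc d}
    {s : UnitSphere d} (h : |F (x + δ • (s : Euc d))| ≤ M) :
    ‖gradEstimate F δ x s‖ ≤ d / δ * M := by
  rw [gradEstimate, norm_smul, norm_coe_unitSphere, mul_one, norm_mul, Real.norm_eq_abs,
    Real.norm_eq_abs, abs_of_nonneg (by positivity)]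
  gcongr

/-- The uniform law is centred, so `F x` may be subtracted inside the mean; the remaining variation
`G δ` cancels the factor `1 / δ`. -/
theorem norm_gradMean_le {d : ℕ} (hd : 0 < d) {F : Euc d → ℝ} (hF : Continuous F) {δ G : ℝ}
    (hδ : 0 < δ) {x : Euc d} (h : ∀ s : UnitSphere d, |F (x + δ • (s : Euc d)) - F x| ≤ G * δ) :
    ‖gradMean F δ x‖ ≤ d * G := by
  have := isProbabilityMeasure_uniformSphere hd
  have hs : Integrable (fun s : UnitSphere d => (s : Euc d)) (uniformSphere d) :=
    Continuous.integrable_uniformSphere hd continuous_subtype_val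
  have hz : ∫ s : UnitSphere d, (s : Euc d) ∂uniformSphere d = 0 := by
    refine ext_inner_left ℝ fun w => ?_
    rw [← integral_inner hs, inner_zero_right, ← integral_inner_uniformSphere hd w]
    simp_rw [real_inner_comm]
  have heq : gradMean F δ x = ∫ s : UnitSphere d,
      ((d : ℝ) / δ * (F (x + δ • (s : Euc d)) - F x)) • (s : Euc d) ∂uniformSphere d := by
    have : ∀ s : UnitSphere d, ((d : ℝ) / δ * (F (x + δ • (s : Euc d)) - F x)) • (s : Euc d) =
        gradEstimate F δ x s - ((d : ℝ) / δ * F x) • (s : Euc d) := by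
      intro s; rw [gradEstimate, ← sub_smul]; congr 1; ring
    simp_rw [this]
    rw [integral_sub (integrable_gradEstimate hd hF δ x) (hs.fun_smul _), integral_smul, hz,
      smul_zero, sub_zero, gradMean]
  rw [heq]
  refine (norm_integral_le_of_norm_le_const (C := d * G) (Eventually.of_forall fun s => ?_)).trans
    (by simp)
  rw [norm_smul, norm_coe_unitSphere, mul_one, norm_mul, Real.norm_eq_abs,
    Real.norm_eq_abs, abs_of_nonneg (by positivity)]
  calc (d : ℝ) / δ * _ ≤ d / δ * (G * δ) := mul_le_mul_of_nonneg_left (h s) (by positivity)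
    _ = d * G := by field_simp

/-- The mean gradient estimate is, up to the smoothing error, a subgradient of a convex
Lipschitz function. -/
theorem sub_le_inner_gradMean {d : ℕ} (hd : 0 < d) {F : Euc d → ℝ} (hF : Continuous F)
    {𝒦 : Set (Euc d)} (hconv : ConvexOn ℝ 𝒦 F) {δ G : ℝ} (hδ : 0 < δ)
    (hG : ∀ a ∈ 𝒦, ∀ b ∈ 𝒦, |F a - F b| ≤ G * ‖a - b‖) (hG0 : 0 ≤ G) {x y : Euc d}
    (hx : ∀ v : Euc d, ‖v‖ ≤ 1 → x + δ • v ∈ 𝒦) (hy : ∀ v : Euc d, ‖v‖ ≤ 1 → y + δ • v ∈ 𝒦) :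
    F x - F y ≤ ⟪gradMean F δ x, x - y⟫ + 2 * (G * δ) := by
  -- With this scaling, shifting `v` by `t • w` moves `x + δ v` a fraction `t` of the way to `y + δ
  -- v`, where convexity applies.
  set w : Euc d := δ⁻¹ • (y - x)
  have hg : Continuous (fun v => F (x + δ • v)) := by fun_prop
  have hlim := tendsto_slope_integral_ball hd hg w
  set B := Metric.ball (0 : Euc d) 1
  have hint : ∀ φ : Euc d → ℝ, Continuous φ → IntegrableOn φ B := fun φ hφ =>
    (hφ.continuousOn.integrableOn_compact (isCompact_closedBall (0 : Euc d) 1)).mono_set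
        Metric.ball_subset_closedBall
  have hx0 : x ∈ 𝒦 := by simpa using hx 0 (by simp)
  have hy0 : y ∈ 𝒦 := by simpa using hy 0 (by simp)
  have hclose : ∀ z ∈ 𝒦, ∀ v : Euc d, ‖v‖ ≤ 1 → z + δ • v ∈ 𝒦 → |F (z + δ • v) - F z| ≤ G * δ := by
    intro z hz v hv hzv
    refine (hG _ hzv _ hz).trans (mul_le_mul_of_nonneg_left ?_ hG0)
    rw [add_sub_cancel_left, norm_smul, Real.norm_eq_abs, abs_of_pos hδ]
    nlinarith
  have hle : ∀ᶠ t : ℝ in 𝓝[>] 0, t⁻¹ * ((∫ v in B, F (x + δ • (v + t • w))) -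
      ∫ v in B, F (x + δ • v)) ≤ volume.real B * (F y - F x + 2 * (G * δ)) := by
    have h1 : ∀ᶠ t : ℝ in 𝓝[>] 0, t < 1 :=
      nhdsWithin_le_nhds (gt_mem_nhds (by norm_num : (0 : ℝ) < 1))
    filter_upwards [h1, eventually_mem_nhdsWithin] with t ht1 ht0
    have ht0 : 0 < t := ht0
    rw [← integral_sub (hint _ (by fun_prop)) (hint _ (by fun_prop)), ← integral_const_mul]
    have : volume.real B * (F y - F x + 2 * (G * δ)) =
        ∫ v in B, (F y - F x + 2 * (G * δ)) := by
      simp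
    rw [this]
    refine setIntegral_mono_on ((hint _ (by fun_prop))) (hint _ continuous_const)
      Metric.isOpen_ball.measurableSet fun v hv => ?_
    have hv1 : ‖v‖ ≤ 1 := (mem_ball_zero_iff.1 hv).le
    have hpt : x + δ • (v + t • w) = (1 - t) • (x + δ • v) + t • (y + δ • v) := by
      have hw : δ • (t • w) = t • (y - x) := by
        rw [smul_comm, smul_inv_smul₀ hδ.ne']
      rw [smul_add, hw]
      module
    have hc := hconv.2 (hx v hv1) (hy v hv1) (by linarith : 0 ≤ 1 - t) ht0.le (by ring)
    rw [← hpt] at hc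
    simp only [smul_eq_mul] at hc
    have e1 := abs_le.1 (hclose x hx0 v hv1 (hx v hv1))
    have e2 := abs_le.1 (hclose y hy0 v hv1 (hy v hv1))
    rw [inv_mul_le_iff₀ ht0]
    nlinarith [e1.1, e2.2]
  have hfin := le_of_tendsto hlim hle
  have hvol := volume_unitBall_pos d
  -- The factor `d / δ` of the estimate is what makes this exact: the sphere has area `d` times the
  -- volume of the ball, and `w` carries `δ⁻¹`.
  have hconn : ∫ s : UnitSphere d, F (x + δ • (s : Euc d)) * ⟪(s : Euc d), w⟫
      ∂(volume : Measure (Euc d)).toSphere = volume.real B * ⟪gradMean F δ x, y - x⟫ := by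
    rw [inner_gradMean hd hF, integral_uniformSphere, smul_eq_mul, ← integral_const_mul,
      ← integral_const_mul]
    refine integral_congr_ae (Eventually.of_forall fun s => ?_)
    simp only [gradEstimate, w, inner_smul_left, inner_smul_right, conj_trivial]
    have : volume.real B ≠ 0 := hvol.ne'
    have hd' : (d : ℝ) ≠ 0 := by positivity
    change _ = volume.real B * ((d * volume.real B)⁻¹ * _)
    field_simp
  rw [hconn, mul_le_mul_iff_right₀ hvol] at hfin
  have : ⟪gradMean F δ x, x - y⟫ = - ⟪gradMean F δ x, y - x⟫ := by
    rw [← inner_neg_right, neg_sub]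
  linarith

/-! ### The conditional gradient method on the quadratic surrogate -/

/-- The regularised linear loss `x ↦ ⟪z, x⟫ + h ‖x - a‖²`. -/
def linReg {d : ℕ} (h : ℝ) (a z x : Euc d) : ℝ := ⟪z, x⟫ + h * ‖x - a‖ ^ 2

theorem surrogate_zero {d : ℕ} (h : ℝ) (K m : ℕ) (a z : Euc d) :
    surrogate 0 h K m a z = linReg h a z := by
  ext x; simp [surrogate, linReg]

/-- The second-order expansion of a quadratic is exact; this one identity yields the gradient, the
smoothness and the strong convexity used below. -/
theorem linReg_add {d : ℕ} (h : ℝ) (a z x w : Euc d) :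
    linReg h a z (x + w) = linReg h a z x + ⟪z + (2 * h) • (x - a), w⟫ + h * ‖w‖ ^ 2 := by
  have : x + w - a = (x - a) + w := by abel
  rw [linReg, linReg, this, norm_add_sq_real, inner_add_left, inner_add_right, inner_smul_left]
  simp only [conj_trivial]
  ring

theorem hasGradientAt_linReg {d : ℕ} (h : ℝ) (a z x : Euc d) :
    HasGradientAt (linReg h a z) (z + (2 * h) • (x - a)) x := by
  rw [hasGradientAt_iff_isLittleO]
  have : (fun x' => linReg h a z x' - linReg h a z x - ⟪z + (2 * h) • (x - a), x' - x⟫) =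
      fun x' => h * ‖x' - x‖ ^ 2 := by
    ext x'
    have := linReg_add h a z x (x' - x)
    rw [add_sub_cancel] at this
    rw [this]; ring
  rw [this]
  refine Asymptotics.IsLittleO.const_mul_left ?_ h
  have h2 : (fun x' => ‖x' - x‖ ^ 2) =o[𝓝 x] fun x' => ‖x' - x‖ ^ 1 := by
    have ht : Tendsto (fun x' => ‖x' - x‖) (𝓝 x) (𝓝 0) := by
      have : Continuous fun x' : Euc d => ‖x' - x‖ := by fun_prop
      simpa using this.tendsto x
    exact (Asymptotics.isLittleO_pow_pow (one_lt_two)).comp_tendsto ht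
  simp only [pow_one] at h2
  exact h2.of_norm_right

theorem IsCGRun.mem {d : ℕ} {S : Set (Euc d)} (hS : Convex ℝ S) {L : ℕ} {F : Euc d → ℝ}
    {x₀ : Euc d} (hx₀ : x₀ ∈ S) {c v : ℕ → Euc d} {s : ℕ → ℝ} {xout : Euc d}
    (H : IsCGRun S L F x₀ c v s xout) : ∀ τ ≤ L, c τ ∈ S := by
  intro τ
  induction τ with
  | zero => intro _; rwa [H.init]
  | succ τ ih =>
    intro hτ
    rw [H.next τ hτ]
    exact hS.add_smul_sub_mem (ih (by omega)) (H.lin_mem τ hτ) (H.step_mem τ hτ)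

/-- Convergence rate of the conditional gradient method with line search. -/
theorem IsCGRun.gap_le {d : ℕ} {S : Set (Euc d)} (hS : Convex ℝ S) {R : ℝ}
    (hSR : S ⊆ Metric.closedBall 0 R) {h : ℝ} (hh : 0 ≤ h) {a z : Euc d} {L : ℕ} (hL : 0 < L)
    {x₀ : Euc d} (hx₀ : x₀ ∈ S) {c v : ℕ → Euc d} {s : ℕ → ℝ} {xout : Euc d}
    (H : IsCGRun S L (linReg h a z) x₀ c v s xout) {y : Euc d} (hy : y ∈ S) :
    linReg h a z xout - linReg h a z y ≤ 16 * h * R ^ 2 / (L + 2) := by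
  have hmem := H.mem hS hx₀
  set F := linReg h a z
  have step : ∀ τ < L, ∀ q ∈ Icc (0 : ℝ) 1, F (c (τ + 1)) - F y ≤
      (1 - q) * (F (c τ) - F y) + 4 * h * R ^ 2 * q ^ 2 := by
    intro τ hτ q hq
    -- Line search does at least as well as any prescribed step, so `q` stays free for the analysis.
    have h1 : F (c (τ + 1)) ≤ F (c τ + q • (v τ - c τ)) := by
      rw [H.next τ hτ]; exact H.step_min τ hτ hq
    have hgrad : ∇ F (c τ) = z + (2 * h) • (c τ - a) := (hasGradientAt_linReg h a z (c τ)).gradient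
    have h2 := H.lin_min τ hτ hy
    simp only [mem_ofPred_eq, hgrad] at h2
    have h3 := linReg_add h a z (c τ) (y - c τ)
    rw [add_sub_cancel, inner_sub_right] at h3
    have h4 := linReg_add h a z (c τ) (q • (v τ - c τ))
    rw [inner_smul_right, inner_sub_right, norm_smul, Real.norm_eq_abs, abs_of_nonneg hq.1] at h4
    have h5 : ‖v τ - c τ‖ ≤ 2 * R := by
      have e1 := mem_closedBall_zero_iff.1 (hSR (H.lin_mem τ hτ))
      have e2 := mem_closedBall_zero_iff.1 (hSR (hmem τ hτ.le))
      linarith [norm_sub_le (v τ) (c τ)]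
    have h6 : ‖v τ - c τ‖ ^ 2 ≤ 4 * R ^ 2 := by nlinarith [norm_nonneg (v τ - c τ)]
    have h7 : h * (q * ‖v τ - c τ‖) ^ 2 ≤ 4 * h * R ^ 2 * q ^ 2 := by
      have : h * q ^ 2 * ‖v τ - c τ‖ ^ 2 ≤ h * q ^ 2 * (4 * R ^ 2) :=
        mul_le_mul_of_nonneg_left h6 (by positivity)
      nlinarith
    have h8 : 0 ≤ h * ‖y - c τ‖ ^ 2 := by positivity
    have h9 : q * (⟪z + (2 * h) • (c τ - a), v τ⟫ - ⟪z + (2 * h) • (c τ - a), c τ⟫) ≤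
        q * (F y - F (c τ)) := by
      refine mul_le_mul_of_nonneg_left ?_ hq.1
      linarith
    nlinarith
  have main : ∀ τ, 0 < τ → τ ≤ L → F (c τ) - F y ≤ 16 * h * R ^ 2 / (τ + 2) := by
    intro τ hτ
    induction τ, hτ using Nat.le_induction with
    | base =>
      intro h1
      have := step 0 (by omega) 1 ⟨by norm_num, le_rfl⟩
      have hp : 0 ≤ h * R ^ 2 := by positivity
      norm_num at this ⊢
      linarith
    | succ τ hτ ih =>
      intro h1
      have ih' := ih (by omega)
      have hτ0 : (1 : ℝ) ≤ τ := by exact_mod_cast hτ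
      -- The classical open-loop step size, used only as a competitor to the line search.
      have hq : (2 / ((τ : ℝ) + 2)) ∈ Icc (0 : ℝ) 1 :=
        ⟨by positivity, by rw [div_le_one (by positivity)]; linarith⟩
      have := step τ (by omega) _ hq
      have hp : 0 ≤ h * R ^ 2 := by positivity
      have e1 : (1 - 2 / ((τ : ℝ) + 2)) * (F (c τ) - F y) ≤
          (1 - 2 / ((τ : ℝ) + 2)) * (16 * h * R ^ 2 / (τ + 2)) :=
        mul_le_mul_of_nonneg_left ih' (by linarith [hq.2])
      have e2 : (1 - 2 / ((τ : ℝ) + 2)) * (16 * h * R ^ 2 / (τ + 2)) +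
          4 * h * R ^ 2 * (2 / ((τ : ℝ) + 2)) ^ 2 =
          h * R ^ 2 * (16 * (τ + 1) / (τ + 2) ^ 2) := by
        field_simp; ring
      have e3 : 16 * ((τ : ℝ) + 1) / (τ + 2) ^ 2 ≤ 16 / (τ + 3) := by
        rw [div_le_div_iff₀ (by positivity) (by positivity)]
        nlinarith
      have e4 := mul_le_mul_of_nonneg_left e3 hp
      push_cast
      have e5 : h * R ^ 2 * (16 / ((τ : ℝ) + 3)) = 16 * h * R ^ 2 / (τ + 1 + 2) := by
        have : (τ : ℝ) + 1 + 2 = τ + 3 := by ring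
        rw [this]; ring
      linarith
  rw [← H.output]
  exact main L hL le_rfl

/-! ### Regularised minimizers: stability and the leader bound -/

/-- A selection `prox` of the minimizers over `S` of `⟪z, ·⟫ + h ‖· - a‖²`, with its quadratic
growth. -/
structure IsProx {d : ℕ} (S : Set (Euc d)) (h : ℝ) (a : Euc d) (prox : Euc d → Euc d) : Prop where
  mem : ∀ z, prox z ∈ S
  growth : ∀ z, ∀ x ∈ S, h * ‖x - prox z‖ ^ 2 ≤ linReg h a z x - linReg h a z (prox z)

theorem exists_isProx {d : ℕ} {S : Set (Euc d)} (hS : Convex ℝ S) (hSc : IsCompact S)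
    (hSn : S.Nonempty) (h : ℝ) (a : Euc d) : ∃ prox, IsProx S h a prox := by
  have hex : ∀ z, ∃ y ∈ S, IsMinOn (linReg h a z) S y := fun z =>
    hSc.exists_isMinOn hSn (by unfold linReg; fun_prop)
  choose prox hmem hmin using hex
  refine ⟨prox, hmem, fun z x hx => ?_⟩
  set y := prox z
  set b := ⟪z + (2 * h) • (y - a), x - y⟫ with hb
  have hexp := linReg_add h a z y (x - y)
  rw [add_sub_cancel] at hexp
  -- First-order optimality: compare the minimizer with points at fraction `q` towards `x`, divide
  -- by `q`, and let `q` tend to zero.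
  have hb0 : 0 ≤ b := by
    have hq : ∀ᶠ q : ℝ in 𝓝[>] 0, 0 ≤ b + q * (h * ‖x - y‖ ^ 2) := by
      have h1 : ∀ᶠ t : ℝ in 𝓝[>] 0, t < 1 :=
        nhdsWithin_le_nhds (gt_mem_nhds (by norm_num : (0 : ℝ) < 1))
      filter_upwards [h1, eventually_mem_nhdsWithin] with q hq1 hq0
      have hq0 : 0 < q := hq0
      have hm : y + q • (x - y) ∈ S := hS.add_smul_sub_mem (hmem z) hx ⟨hq0.le, hq1.le⟩
      have := hmin z hm
      simp only [mem_ofPred_eq] at this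
      rw [linReg_add, inner_smul_right, norm_smul, Real.norm_eq_abs, abs_of_pos hq0] at this
      have h3 : 0 ≤ q * (b + q * (h * ‖x - y‖ ^ 2)) := by nlinarith
      exact nonneg_of_mul_nonneg_right h3 hq0
    have hlim : Tendsto (fun q : ℝ => b + q * (h * ‖x - y‖ ^ 2)) (𝓝[>] 0) (𝓝 (b + 0 * _)) :=
      ((by fun_prop : Continuous fun q : ℝ => b + q * (h * ‖x - y‖ ^ 2)).tendsto 0).mono_left
        nhdsWithin_le_nhds
    rw [zero_mul, add_zero] at hlim
    exact ge_of_tendsto hlim hq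
  linarith

namespace IsProx

variable {d : ℕ} {S : Set (Euc d)} {h : ℝ} {a : Euc d} {prox : Euc d → Euc d}

/-- Add the growth inequalities of the two minimizers, each tested at the other, and apply
Cauchy–Schwarz. -/
theorem norm_sub_le (H : IsProx S h a prox) (hh : 0 < h) (z z' : Euc d) :
    ‖prox z - prox z'‖ ≤ ‖z - z'‖ / (2 * h) := by
  have h1 := H.growth z _ (H.mem z')
  have h2 := H.growth z' _ (H.mem z)
  rw [norm_sub_rev] at h1
  simp only [linReg] at h1 h2
  have h3 : 2 * h * ‖prox z - prox z'‖ ^ 2 ≤ ⟪z - z', prox z' - prox z⟫ := by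
    rw [inner_sub_left, inner_sub_right, inner_sub_right]; linarith
  have h4 := real_inner_le_norm (z - z') (prox z' - prox z)
  rw [norm_sub_rev (prox z')] at h4
  rw [le_div_iff₀ (by positivity)]
  by_contra! hcon
  have hpos : 0 < ‖prox z - prox z'‖ := by
    by_contra! h0
    have h0' : ‖prox z - prox z'‖ = 0 := le_antisymm h0 (norm_nonneg _)
    rw [h0'] at hcon
    linarith [norm_nonneg (z - z')]
  nlinarith

/-- This makes the common starting point a minimizer for the zero dual variable, so the first block
fits the pattern of the later ones. -/
theorem zero (H : IsProx S h a prox) (hh : 0 < h) (ha : a ∈ S) : prox 0 = a := by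
  have h1 := H.growth 0 a ha
  simp only [linReg, inner_zero_left, sub_self, norm_zero] at h1
  rw [norm_sub_rev] at h1
  have : ‖prox 0 - a‖ ^ 2 ≤ 0 := by nlinarith
  have : ‖prox 0 - a‖ = 0 := by nlinarith [norm_nonneg (prox 0 - a)]
  exact sub_eq_zero.1 (norm_eq_zero.1 this)

/-- The be-the-leader bound. -/
theorem sum_inner_le (H : IsProx S h a prox) (hh : 0 ≤ h) {R : ℝ}
    (hSR : S ⊆ Metric.closedBall 0 R) (ha : a ∈ S) (b : ℕ → Euc d) {x : Euc d} (hx : x ∈ S) (N : ℕ) :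
    ∑ m ∈ Finset.range N, ⟪b m, prox (∑ k ∈ Finset.range (m + 1), b k) - x⟫ ≤ 4 * h * R ^ 2 := by
  have key : ∀ N, ∀ x ∈ S,
      ∑ m ∈ Finset.range N, ⟪b m, prox (∑ k ∈ Finset.range (m + 1), b k)⟫ ≤
      linReg h a (∑ k ∈ Finset.range N, b k) x := by
    intro N
    induction N with
    | zero => intro x _; simp only [Finset.range_zero, Finset.sum_empty, linReg, inner_zero_left]; positivity
    | succ N ih =>
      intro x hx
      rw [Finset.sum_range_succ]
      -- The induction hypothesis is used at the next leader, which then is compared with `x` by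
      -- minimality.
      have h1 := ih _ (H.mem (∑ k ∈ Finset.range (N + 1), b k))
      have h2 := H.growth (∑ k ∈ Finset.range (N + 1), b k) x hx
      have h3 : 0 ≤ h * ‖x - prox (∑ k ∈ Finset.range (N + 1), b k)‖ ^ 2 := by positivity
      have h4 : linReg h a (∑ k ∈ Finset.range (N + 1), b k)
          (prox (∑ k ∈ Finset.range (N + 1), b k)) =
          linReg h a (∑ k ∈ Finset.range N, b k) (prox (∑ k ∈ Finset.range (N + 1), b k)) +
          ⟪b N, prox (∑ k ∈ Finset.range (N + 1), b k)⟫ := by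
        simp only [linReg]
        nth_rewrite 1 [Finset.sum_range_succ]
        rw [inner_add_left]; ring
      linarith
  have h1 := key N x hx
  simp_rw [inner_sub_right]
  rw [Finset.sum_sub_distrib, ← sum_inner]
  simp only [linReg] at h1
  have h5 : ‖x - a‖ ≤ 2 * R := by
    have e1 := mem_closedBall_zero_iff.1 (hSR hx)
    have e2 := mem_closedBall_zero_iff.1 (hSR ha)
    linarith [_root_.norm_sub_le x a]
  have h6 : ‖x - a‖ ^ 2 ≤ 4 * R ^ 2 := by nlinarith [norm_nonneg (x - a)]
  nlinarith

/-- The output of the conditional gradient method is close to the minimizer. -/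
theorem norm_cg_sub_le (H : IsProx S h a prox) (hS : Convex ℝ S) {R : ℝ}
    (hR : 0 ≤ R) (hSR : S ⊆ Metric.closedBall 0 R) (hh : 0 < h) {z : Euc d} {L : ℕ} (hL : 0 < L)
    {x₀ : Euc d} (hx₀ : x₀ ∈ S) {c v : ℕ → Euc d} {s : ℕ → ℝ} {xout : Euc d}
    (hrun : IsCGRun S L (linReg h a z) x₀ c v s xout) : ‖xout - prox z‖ ≤ 4 * R / √L := by
  have hout : xout ∈ S := by rw [← hrun.output]; exact hrun.mem hS hx₀ L le_rfl
  have h1 := hrun.gap_le hS hSR hh.le hL hx₀ (H.mem z)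
  have h2 := H.growth z xout hout
  have hL0 : (0 : ℝ) < L := by exact_mod_cast hL
  have h3 : 16 * h * R ^ 2 / (L + 2) ≤ 16 * h * R ^ 2 / L :=
    div_le_div_of_nonneg_left (by positivity) hL0 (by linarith)
  -- Both the optimality gap and the growth are proportional to `h`, which cancels.
  have h4 : ‖xout - prox z‖ ^ 2 ≤ (4 * R / √L) ^ 2 := by
    rw [div_pow, Real.sq_sqrt hL0.le]
    have : h * ‖xout - prox z‖ ^ 2 ≤ h * ((4 * R) ^ 2 / L) := by
      calc _ ≤ 16 * h * R ^ 2 / L := by linarith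
        _ = _ := by ring
    exact le_of_mul_le_mul_left this hh
  exact le_of_sq_le_sq h4 (by positivity)

end IsProx

/-! ### Gossip averaging and the consensus error -/

theorem sigmaTwo_nonneg {n : ℕ} (P : Matrix (Fin n) (Fin n) ℝ) : 0 ≤ sigmaTwo P :=
  LinearMap.singularValues_nonneg _ _

theorem IsGossipMatrix.row_sum {n : ℕ} {E : Fin n → Fin n → Prop} {P : Matrix (Fin n) (Fin n) ℝ}
    (hP : IsGossipMatrix E P) (i : Fin n) : ∑ j, P i j = 1 :=
  sum_row_of_mem_doublyStochastic hP.doublyStochastic i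

theorem IsGossipMatrix.col_sum {n : ℕ} {E : Fin n → Fin n → Prop} {P : Matrix (Fin n) (Fin n) ℝ}
    (hP : IsGossipMatrix E P) (j : Fin n) : ∑ i, P i j = 1 :=
  sum_col_of_mem_doublyStochastic hP.doublyStochastic j

/-- On vectors with zero sum, a gossip matrix contracts by the second singular value. -/
theorem IsGossipMatrix.norm_toEuclideanLin_le {n : ℕ} {E : Fin n → Fin n → Prop}
    {P : Matrix (Fin n) (Fin n) ℝ} (hP : IsGossipMatrix E P) {y : EuclideanSpace ℝ (Fin n)}
    (hy : ∑ i, y i = 0) :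
    ‖Matrix.toEuclideanLin P y‖ ≤ sigmaTwo P * ‖y‖ := by
  set T := Matrix.toEuclideanLin P with hT
  have hn : Module.finrank ℝ (EuclideanSpace ℝ (Fin n)) = n := by simp
  have hA := T.isSymmetric_adjoint_comp_self
  set b := hA.eigenvectorBasis hn
  set lam := hA.eigenvalues hn
  set one : EuclideanSpace ℝ (Fin n) := WithLp.toLp 2 (fun _ => 1) with hone
  have hTone : T one = one := by
    ext i
    simp [hT, hone, Matrix.toLpLin_apply, Matrix.mulVec, dotProduct, hP.row_sum i]
  have hadj : T.adjoint = T := by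
    rw [hT, ← Matrix.toEuclideanLin_conjTranspose_eq_adjoint, Matrix.conjTranspose_eq_transpose_of_trivial,
      hP.isSymm.eq]
  have hAone : (T.adjoint ∘ₗ T) one = one := by
    rw [hadj]; simp [hTone]
  have hlam : ∀ k : Fin n, (k : ℕ) ≠ 0 → lam k ≤ sigmaTwo P ^ 2 := by
    intro k hk
    refine (T.sq_singularValues_fin hn k).symm.le.trans ?_
    exact pow_le_pow_left₀ (T.singularValues_nonneg _)
      (T.singularValues_antitone (Nat.one_le_iff_ne_zero.2 hk)) 2
  have hσ0 := sigmaTwo_nonneg P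
  have hσ1 := hP.sigmaTwo_lt_one
  -- The constant vector is fixed by `T.adjoint ∘ₗ T`, while the eigenvalues with index `k ≠ 0` are
  -- below one; so it lies on the axis of index `0`.
  have hrep1 : ∀ k : Fin n, (k : ℕ) ≠ 0 → b.repr one k = 0 := by
    intro k hk
    have h1 := hA.eigenvectorBasis_apply_self_apply hn one k
    rw [hAone] at h1
    have h2 : lam k < 1 := by nlinarith [hlam k hk]
    have h3 : (1 - lam k) * b.repr one k = 0 := by
      have : b.repr one k = lam k * b.repr one k := h1
      linarith
    rcases mul_eq_zero.1 h3 with h | h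
    · linarith
    · exact h
  have hinner : ∀ x z : EuclideanSpace ℝ (Fin n), ⟪x, z⟫ = ∑ k, b.repr x k * b.repr z k := by
    intro x z
    rw [← b.repr.inner_map_map, PiLp.inner_apply]
    simp [mul_comm]
  have horth : ⟪one, y⟫ = 0 := by
    rw [PiLp.inner_apply]; simpa [hone] using hy
  -- Consequently a vector orthogonal to the constants has no component along the top eigenvector.
  have hrepy : ∀ k : Fin n, (k : ℕ) = 0 → b.repr y k = 0 := by
    intro k hk
    have hothers : ∀ l : Fin n, l ≠ k → b.repr one l = 0 := fun l hl =>
      hrep1 l (fun h => hl (Fin.ext (h.trans hk.symm)))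
    have h1 : b.repr one k * b.repr y k = 0 := by
      rw [hinner, Finset.sum_eq_single k (fun l _ hl => by rw [hothers l hl, zero_mul])
        (by simp)] at horth
      exact horth
    have h2 : ⟪one, one⟫ = b.repr one k * b.repr one k := by
      rw [hinner, Finset.sum_eq_single k (fun l _ hl => by rw [hothers l hl, zero_mul]) (by simp)]
    have h3 : ⟪one, one⟫ = (n : ℝ) := by
      rw [PiLp.inner_apply]; simp [hone]
    have hn0 : (0 : ℝ) < n := by exact_mod_cast Fin.pos k
    rcases mul_eq_zero.1 h1 with h | h
    · rw [h2, h] at h3; simp at h3; linarith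
    · exact h
  have hsq : ‖T y‖ ^ 2 ≤ (sigmaTwo P * ‖y‖) ^ 2 := by
    rw [mul_pow, ← real_inner_self_eq_norm_sq, ← real_inner_self_eq_norm_sq y,
      ← LinearMap.adjoint_inner_right, ← LinearMap.comp_apply, hinner, hinner, Finset.mul_sum]
    refine Finset.sum_le_sum fun k _ => ?_
    rw [hA.eigenvectorBasis_apply_self_apply hn y k]
    change b.repr y k * (lam k * b.repr y k) ≤ _
    by_cases hk : (k : ℕ) = 0
    · rw [hrepy k hk]; simp
    · nlinarith [hlam k hk, mul_self_nonneg (b.repr y k)]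
  exact le_of_sq_le_sq hsq (by positivity)

/-- The Frobenius norm of a family of vectors. -/
def frob {n d : ℕ} (e : Fin n → Euc d) : ℝ := √(∑ i, ‖e i‖ ^ 2)

theorem frob_eq_norm {n d : ℕ} (e : Fin n → Euc d) : frob e = ‖WithLp.toLp 2 e‖ := by
  rw [PiLp.norm_eq_of_L2]; rfl

theorem frob_add_le {n d : ℕ} (e e' : Fin n → Euc d) : frob (e + e') ≤ frob e + frob e' := by
  simp only [frob_eq_norm, WithLp.toLp_add]
  exact norm_add_le _ _

theorem frob_nonneg {n d : ℕ} (e : Fin n → Euc d) : 0 ≤ frob e := Real.sqrt_nonneg _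

theorem frob_sq {n d : ℕ} (e : Fin n → Euc d) : frob e ^ 2 = ∑ i, ‖e i‖ ^ 2 :=
  Real.sq_sqrt (Finset.sum_nonneg fun _ _ => sq_nonneg _)

theorem norm_le_frob {n d : ℕ} (e : Fin n → Euc d) (i : Fin n) : ‖e i‖ ≤ frob e :=
  Real.le_sqrt_of_sq_le
    (Finset.single_le_sum (f := fun i => ‖e i‖ ^ 2) (fun _ _ => sq_nonneg _) (Finset.mem_univ i))

/-- Mixing acts separately on each of the `d` coordinates, so the scalar contraction can be summed.
-/
theorem IsGossipMatrix.frob_mix_le {n d : ℕ} {E : Fin n → Fin n → Prop}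
    {P : Matrix (Fin n) (Fin n) ℝ} (hP : IsGossipMatrix E P) {e : Fin n → Euc d}
    (he : ∑ i, e i = 0) : frob (fun i => ∑ j, P i j • e j) ≤ sigmaTwo P * frob e := by
  refine le_of_sq_le_sq ?_ (mul_nonneg (sigmaTwo_nonneg P) (frob_nonneg e))
  rw [mul_pow, frob_sq, frob_sq]
  simp_rw [EuclideanSpace.real_norm_sq_eq]
  rw [Finset.sum_comm, Finset.sum_comm (s := Finset.univ) (t := Finset.univ)
    (f := fun i k => (e i) k ^ 2), Finset.mul_sum]
  refine Finset.sum_le_sum fun k _ => ?_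
  set y : EuclideanSpace ℝ (Fin n) := WithLp.toLp 2 (fun i => e i k) with hy
  have hy0 : ∑ i, y i = 0 := by
    have := congrArg (fun v : Euc d => v k) he
    simpa [hy] using this
  have h1 := pow_le_pow_left₀ (norm_nonneg _) (hP.norm_toEuclideanLin_le hy0) 2
  rw [mul_pow, EuclideanSpace.real_norm_sq_eq, EuclideanSpace.real_norm_sq_eq] at h1
  simpa [hy, Matrix.toLpLin_apply, Matrix.mulVec, dotProduct] using h1

/-- The nodeMean of a family of vectors. -/
def nodeMean {n d : ℕ} (e : Fin n → Euc d) : Euc d := (n : ℝ)⁻¹ • ∑ i, e i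

theorem sum_eq_smul_nodeMean {n d : ℕ} (i₀ : Fin n) (e : Fin n → Euc d) :
    ∑ i, e i = (n : ℝ) • nodeMean e := by
  have : (n : ℝ) ≠ 0 := by exact_mod_cast (Fin.pos i₀).ne'
  rw [nodeMean, smul_inv_smul₀ this]

theorem sum_sub_nodeMean {n d : ℕ} (e : Fin n → Euc d) : ∑ i, (e i - nodeMean e) = 0 := by
  rcases Nat.eq_zero_or_pos n with h | h
  · subst h; simp
  · rw [Finset.sum_sub_distrib, sum_eq_smul_nodeMean ⟨0, h⟩ e]
    simp [← Nat.cast_smul_eq_nsmul ℝ]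

theorem norm_nodeMean_le {n d : ℕ} {e : Fin n → Euc d} {β : ℝ} (hβ : 0 ≤ β) (h : ∀ i, ‖e i‖ ≤ β) :
    ‖nodeMean e‖ ≤ β := by
  rcases Nat.eq_zero_or_pos n with h0 | h0
  · subst h0; simpa [nodeMean] using hβ
  · have hn : (0 : ℝ) < n := by exact_mod_cast h0
    rw [nodeMean, norm_smul, norm_inv, Real.norm_eq_abs, abs_of_pos hn, inv_mul_le_iff₀ hn]
    refine (norm_sum_le _ _).trans ((Finset.sum_le_sum fun i _ => h i).trans (by simp))

/-- By Pythagoras, subtracting the mean does not increase the sum of squares; the triangle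
inequality would cost a factor two. -/
theorem frob_sub_nodeMean_le {n d : ℕ} {e : Fin n → Euc d} {β : ℝ} (hβ : 0 ≤ β)
    (h : ∀ i, ‖e i‖ ≤ β) : frob (fun i => e i - nodeMean e) ≤ √n * β := by
  refine le_of_sq_le_sq ?_ (by positivity)
  rw [frob_sq, mul_pow, Real.sq_sqrt (Nat.cast_nonneg n)]
  have h1 : ∀ i, ‖e i - nodeMean e‖ ^ 2 =
      ‖e i‖ ^ 2 - 2 * ⟪e i - nodeMean e, nodeMean e⟫ - ‖nodeMean e‖ ^ 2 := by
    intro i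
    rw [norm_sub_sq_real, inner_sub_left, real_inner_self_eq_norm_sq]; ring
  have h2 : ∑ i, ⟪e i - nodeMean e, nodeMean e⟫ = 0 := by
    rw [← sum_inner, sum_sub_nodeMean, inner_zero_left]
  calc ∑ i, ‖e i - nodeMean e‖ ^ 2
      = ∑ i, ‖e i‖ ^ 2 - ∑ _i : Fin n, ‖nodeMean e‖ ^ 2 := by
        simp_rw [h1, Finset.sum_sub_distrib]
        rw [← Finset.mul_sum, h2]; ring
    _ ≤ ∑ i, ‖e i‖ ^ 2 := by
        have : 0 ≤ ∑ _i : Fin n, ‖nodeMean e‖ ^ 2 := Finset.sum_nonneg fun _ _ => sq_nonneg _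
        linarith
    _ ≤ ∑ _i : Fin n, β ^ 2 :=
        Finset.sum_le_sum fun i _ => pow_le_pow_left₀ (norm_nonneg _) (h i) 2
    _ = n * β ^ 2 := by simp

theorem IsGossipMatrix.nodeMean_mix {n d : ℕ} {E : Fin n → Fin n → Prop}
    {P : Matrix (Fin n) (Fin n) ℝ} (hP : IsGossipMatrix E P) (e : Fin n → Euc d) :
    nodeMean (fun i => ∑ j, P i j • e j) = nodeMean e := by
  rw [nodeMean, nodeMean, Finset.sum_comm]
  simp_rw [← Finset.sum_smul, hP.col_sum, one_smul]

/-- Consensus error of gossip averaging with bounded increments. -/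
theorem IsGossipMatrix.norm_sub_nodeMean_le {n d : ℕ} {E : Fin n → Fin n → Prop}
    {P : Matrix (Fin n) (Fin n) ℝ} (hP : IsGossipMatrix E P) {N : ℕ} {z b : ℕ → Fin n → Euc d}
    {β : ℝ} (hβ : 0 ≤ β) (hb : ∀ m < N, ∀ i, ‖b m i‖ ≤ β) (hz0 : ∀ i, z 0 i = 0)
    (hz : ∀ m < N, ∀ i, z (m + 1) i = ∑ j, P i j • z m j + b m i) {m : ℕ} (hm : m ≤ N) :
    nodeMean (z m) = ∑ k ∈ Finset.range m, nodeMean (b k) ∧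
      ∀ i, ‖z m i - nodeMean (z m)‖ ≤ √n * β / (1 - sigmaTwo P) := by
  have hσ : 0 < 1 - sigmaTwo P := by linarith [hP.sigmaTwo_lt_one]
  have havg : ∀ m < N, nodeMean (z (m + 1)) = nodeMean (z m) + nodeMean (b m) := by
    intro m hm
    rw [← hP.nodeMean_mix (z m)]
    simp only [nodeMean]
    rw [← smul_add, ← Finset.sum_add_distrib]
    simp_rw [hz m hm]
  have hfrob : ∀ m ≤ N, frob (fun i => z m i - nodeMean (z m)) ≤ √n * β / (1 - sigmaTwo P) := by
    intro m
    induction m with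
    | zero =>
      intro _
      have : (fun i => z 0 i - nodeMean (z 0)) = fun _ => 0 := by
        ext1 i; simp [nodeMean, hz0]
      rw [this]
      simp only [frob, norm_zero, ne_eq, OfNat.ofNat_ne_zero, not_false_eq_true, zero_pow,
        Finset.sum_const_zero, Real.sqrt_zero]
      positivity
    | succ m ih =>
      intro hm
      have ih' := ih (by omega)
      have heq : (fun i => z (m + 1) i - nodeMean (z (m + 1))) =
          (fun i => ∑ j, P i j • (z m j - nodeMean (z m))) + fun i => b m i - nodeMean (b m) := by
        ext1 i
        simp only [Pi.add_apply]
        rw [hz m hm, havg m hm]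
        simp_rw [smul_sub, Finset.sum_sub_distrib, ← Finset.sum_smul, hP.row_sum, one_smul]
        abel
      rw [heq]
      refine (frob_add_le _ _).trans ?_
      have h1 := hP.frob_mix_le (sum_sub_nodeMean (z m))
      have h2 := frob_sub_nodeMean_le hβ (hb m hm)
      have h3 : sigmaTwo P * frob (fun i => z m i - nodeMean (z m)) ≤
          sigmaTwo P * (√n * β / (1 - sigmaTwo P)) :=
        mul_le_mul_of_nonneg_left ih' (sigmaTwo_nonneg P)
      -- The bound is the fixed point of `q ↦ σ₂ q + √n β`, that is, the sum of the geometric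
      -- series.
      have h4 : sigmaTwo P * (√n * β / (1 - sigmaTwo P)) + √n * β = √n * β / (1 - sigmaTwo P) := by
        field_simp; ring
      linarith
  refine ⟨?_, fun i => (norm_le_frob (fun i => z m i - nodeMean (z m)) i).trans (hfrob m hm)⟩
  clear hfrob
  induction m with
  | zero => simp [nodeMean, hz0]
  | succ m ih => rw [havg m hm, ih (by omega), Finset.sum_range_succ]

/-! ### Concentration of sums of centred increments -/

/-- Hoeffding's lemma in `ℝ≥0∞` for a centred bounded function. -/
theorem lintegral_exp_mul_le {S : Type*} [MeasurableSpace S] {ν : Measure S}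
    [IsProbabilityMeasure ν] {φ : S → ℝ} (hφ : Measurable φ) {b : ℝ} (hb : ∀ s, |φ s| ≤ b)
    (h0 : ∫ s, φ s ∂ν = 0) (lam : ℝ) :
    ∫⁻ s, ENNReal.ofReal (Real.exp (lam * φ s)) ∂ν ≤
      ENNReal.ofReal (Real.exp (lam ^ 2 * b ^ 2 / 2)) := by
  have hsub := hasSubgaussianMGF_of_mem_Icc_of_integral_eq_zero (μ := ν) (a := -b) (b := b)
    hφ.aemeasurable (Eventually.of_forall fun s => abs_le.1 (hb s)) h0
  rw [← ofReal_integral_eq_lintegral_ofReal (hsub.integrable_exp_mul lam)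
    (Eventually.of_forall fun s => (Real.exp_pos _).le)]
  refine ENNReal.ofReal_le_ofReal ((hsub.mgf_le lam).trans (Real.exp_le_exp.2 (le_of_eq ?_)))
  simp only [NNReal.coe_pow, NNReal.coe_div, coe_nnnorm, Real.norm_eq_abs, NNReal.coe_ofNat]
  rw [div_pow, sq_abs]; ring

/-- An Azuma–Hoeffding inequality: the increments are centred bounded functions of a state known
before a round and of fresh randomness of that round. -/
theorem measure_sum_ge_le_exp {Ω X S : Type*} [mΩ : MeasurableSpace Ω] [MeasurableSpace X]
    [MeasurableSpace S] {μ : Measure Ω} [IsProbabilityMeasure μ] {ν : Measure S}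
    [IsProbabilityMeasure ν] {ℱ : Filtration ℕ mΩ} {x : ℕ → Ω → X} {u : ℕ → Ω → S}
    {φ : ℕ → X × S → ℝ} {t₀ N : ℕ} {b : ℝ} (hb : 0 < b) (hN : 0 < N)
    (hφ : ∀ t, t₀ ≤ t → t < t₀ + N → Measurable (φ t))
    (hx : ∀ t, t₀ ≤ t → t < t₀ + N → Measurable[ℱ t] (x t))
    (hu : ∀ t, t₀ ≤ t → t < t₀ + N → Measurable[ℱ (t + 1)] (u (t + 1)))
    (hlaw : ∀ t, t₀ ≤ t → t < t₀ + N → μ.map (u (t + 1)) = ν)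
    (hind : ∀ t, t₀ ≤ t → t < t₀ + N →
      Indep (MeasurableSpace.comap (u (t + 1)) inferInstance) (ℱ t) μ)
    (hbound : ∀ t, t₀ ≤ t → t < t₀ + N → ∀ ω s, |φ t (x t ω, s)| ≤ b)
    (hmean : ∀ t, t₀ ≤ t → t < t₀ + N → ∀ ω, ∫ s, φ t (x t ω, s) ∂ν = 0) {ε : ℝ} (hε : 0 ≤ ε) :
    μ {ω | ε ≤ ∑ k ∈ Finset.range N, φ (t₀ + k) (x (t₀ + k) ω, u (t₀ + k + 1) ω)} ≤
      ENNReal.ofReal (Real.exp (-ε ^ 2 / (2 * N * b ^ 2))) := by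
  set D : ℕ → Ω → ℝ := fun k ω => φ (t₀ + k) (x (t₀ + k) ω, u (t₀ + k + 1) ω)
  set Sm : ℕ → Ω → ℝ := fun k ω => ∑ l ∈ Finset.range k, D l ω with hSm
  have hD : ∀ k < N, Measurable[ℱ (t₀ + k + 1)] (D k) := by
    intro k hk
    have h1 : Measurable[ℱ (t₀ + k + 1)] (x (t₀ + k)) :=
      (hx _ (by omega) (by omega)).mono (ℱ.mono (by omega)) le_rfl
    exact (hφ _ (by omega) (by omega)).comp (h1.prodMk (hu _ (by omega) (by omega)))
  have hSmeas : ∀ k ≤ N, Measurable[ℱ (t₀ + k)] (Sm k) := by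
    intro k hk
    refine Finset.measurable_fun_sum _ fun l hl => ?_
    have hl' := Finset.mem_range.1 hl
    exact (hD l (by omega)).mono (ℱ.mono (by omega)) le_rfl
  -- The minimizer of the Chernoff exponent `-λ ε + N λ² b² / 2`.
  set lam : ℝ := ε / (N * b ^ 2)
  have hN' : (0 : ℝ) < N := by exact_mod_cast hN
  have hmgf : ∀ k ≤ N, ∫⁻ ω, ENNReal.ofReal (Real.exp (lam * Sm k ω)) ∂μ ≤
      ENNReal.ofReal (Real.exp (k * (lam ^ 2 * b ^ 2 / 2))) := by
    intro k
    induction k with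
    | zero => intro _; simp [hSm]
    | succ k ih =>
      intro hk
      have ih' := ih (by omega)
      have h1 : t₀ ≤ t₀ + k := by omega
      have h2 : t₀ + k < t₀ + N := by omega
      have hS' : Measurable[ℱ (t₀ + k)] (fun ω => (Sm k ω, x (t₀ + k) ω)) :=
        (hSmeas k (by omega)).prodMk (hx _ h1 h2)
      have hSm' : Measurable (fun ω => (Sm k ω, x (t₀ + k) ω)) := hS'.mono (ℱ.le _) le_rfl
      have hu' : Measurable (u (t₀ + k + 1)) := (hu _ h1 h2).mono (ℱ.le _) le_rfl
      -- The past enters only through the partial sum and the state. Their joint law with the fresh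
      -- direction is a product, so that direction can be integrated first; this replaces
      -- conditional expectations.
      have hindep : IndepFun (fun ω => (Sm k ω, x (t₀ + k) ω)) (u (t₀ + k + 1)) μ := by
        rw [IndepFun_iff_Indep]
        exact (indep_of_indep_of_le_right (hind _ h1 h2) hS'.comap_le).symm
      have hprod := (indepFun_iff_map_prod_eq_prod_map_map hSm'.aemeasurable hu'.aemeasurable).1
        hindep
      rw [hlaw _ h1 h2] at hprod
      set Ψ : (ℝ × X) × S → ENNReal := fun p =>
        ENNReal.ofReal (Real.exp (lam * p.1.1)) *
          ENNReal.ofReal (Real.exp (lam * φ (t₀ + k) (p.1.2, p.2)))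
      have hφk := hφ _ h1 h2
      have hΨ : Measurable Ψ := by
        have : Measurable fun p : (ℝ × X) × S => φ (t₀ + k) (p.1.2, p.2) :=
          hφk.comp ((measurable_snd.comp measurable_fst).prodMk measurable_snd)
        fun_prop
      calc ∫⁻ ω, ENNReal.ofReal (Real.exp (lam * Sm (k + 1) ω)) ∂μ
          = ∫⁻ ω, Ψ ((Sm k ω, x (t₀ + k) ω), u (t₀ + k + 1) ω) ∂μ := by
            refine lintegral_congr fun ω => ?_
            simp only [Ψ, hSm, Finset.sum_range_succ]
            rw [← ENNReal.ofReal_mul (Real.exp_pos _).le, ← Real.exp_add, mul_add]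
        _ = ∫⁻ p, Ψ p ∂(μ.map fun ω => ((Sm k ω, x (t₀ + k) ω), u (t₀ + k + 1) ω)) :=
            (lintegral_map hΨ (hSm'.prodMk hu')).symm
        _ = ∫⁻ q, ∫⁻ s, Ψ (q, s) ∂ν ∂(μ.map fun ω => (Sm k ω, x (t₀ + k) ω)) := by
            rw [hprod, lintegral_prod _ hΨ.aemeasurable]
        _ = ∫⁻ ω, ∫⁻ s, Ψ ((Sm k ω, x (t₀ + k) ω), s) ∂ν ∂μ :=
            lintegral_map hΨ.lintegral_prod_right' hSm'
        _ ≤ ∫⁻ ω, ENNReal.ofReal (Real.exp (lam * Sm k ω)) *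
              ENNReal.ofReal (Real.exp (lam ^ 2 * b ^ 2 / 2)) ∂μ := by
            refine lintegral_mono fun ω => ?_
            have hm : Measurable fun s => φ (t₀ + k) (x (t₀ + k) ω, s) :=
              hφk.comp measurable_prodMk_left
            simp only [Ψ]
            rw [lintegral_const_mul _ (by fun_prop)]
            gcongr
            exact lintegral_exp_mul_le hm (hbound _ h1 h2 ω) (hmean _ h1 h2 ω) lam
        _ = (∫⁻ ω, ENNReal.ofReal (Real.exp (lam * Sm k ω)) ∂μ) *
              ENNReal.ofReal (Real.exp (lam ^ 2 * b ^ 2 / 2)) := by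
            have : Measurable (Sm k) := (hSmeas k (by omega)).mono (ℱ.le _) le_rfl
            rw [lintegral_mul_const _ (by fun_prop)]
        _ ≤ ENNReal.ofReal (Real.exp (k * (lam ^ 2 * b ^ 2 / 2))) *
              ENNReal.ofReal (Real.exp (lam ^ 2 * b ^ 2 / 2)) := by gcongr
        _ = _ := by
            rw [← ENNReal.ofReal_mul (Real.exp_pos _).le, ← Real.exp_add]
            congr 2; push_cast; ring
  have hSN : Measurable (Sm N) := (hSmeas N le_rfl).mono (ℱ.le _) le_rfl
  have hlam : 0 ≤ lam := by positivity
  have hmarkov := mul_meas_ge_le_lintegral (μ := μ)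
    (f := fun ω => ENNReal.ofReal (Real.exp (lam * Sm N ω))) (by fun_prop)
    (ENNReal.ofReal (Real.exp (lam * ε)))
  have hsub : {ω | ε ≤ Sm N ω} ⊆
      {ω | ENNReal.ofReal (Real.exp (lam * ε)) ≤ ENNReal.ofReal (Real.exp (lam * Sm N ω))} := by
    intro ω hω
    exact ENNReal.ofReal_le_ofReal (Real.exp_le_exp.2 (mul_le_mul_of_nonneg_left hω hlam))
  have hmain : ENNReal.ofReal (Real.exp (lam * ε)) * μ {ω | ε ≤ Sm N ω} ≤
      ENNReal.ofReal (Real.exp (N * (lam ^ 2 * b ^ 2 / 2))) :=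
    ((mul_le_mul_right (measure_mono hsub) _).trans hmarkov).trans (hmgf N le_rfl)
  have hexp : ENNReal.ofReal (Real.exp (-ε ^ 2 / (2 * N * b ^ 2))) =
      ENNReal.ofReal (Real.exp (-(lam * ε))) *
        ENNReal.ofReal (Real.exp (N * (lam ^ 2 * b ^ 2 / 2))) := by
    rw [← ENNReal.ofReal_mul (Real.exp_pos _).le, ← Real.exp_add]
    congr 2
    simp only [lam]
    field_simp
    ring
  rw [hexp]
  calc μ {ω | ε ≤ Sm N ω}
      = ENNReal.ofReal (Real.exp (-(lam * ε))) *
          (ENNReal.ofReal (Real.exp (lam * ε)) * μ {ω | ε ≤ Sm N ω}) := by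
        rw [← mul_assoc, ← ENNReal.ofReal_mul (Real.exp_pos _).le, ← Real.exp_add]
        simp
    _ ≤ _ := by gcongr

/-! ### Geometry of the shrunk set -/

section Shrink

variable {d : ℕ} {𝒦 : Set (Euc d)} {r δ R : ℝ}

/-- The perturbed point is the convex combination of a point of `𝒦` and of `r • v`, with weight `δ /
r` on the latter. -/
theorem add_smul_mem_of_mem_shrink (hK : Convex ℝ 𝒦) (hr : 0 < r)
    (hball : Metric.closedBall 0 r ⊆ 𝒦) (hδ : 0 < δ) (hδr : δ ≤ r) {x : Euc d}
    (hx : x ∈ shrink 𝒦 r δ) {v : Euc d} (hv : ‖v‖ ≤ 1) : x + δ • v ∈ 𝒦 := by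
  obtain ⟨k, hk, rfl⟩ := hx
  have hrv : r • v ∈ 𝒦 := by
    refine hball ?_
    rw [mem_closedBall_zero_iff, norm_smul, Real.norm_eq_abs, abs_of_pos hr]
    nlinarith
  have h1 : δ / r ≤ 1 := (div_le_one hr).2 hδr
  have h2 : 0 ≤ δ / r := by positivity
  have h := hK hk hrv (by linarith : 0 ≤ 1 - δ / r) h2 (by ring)
  rw [smul_smul, div_mul_cancel₀ _ hr.ne'] at h
  exact h

theorem shrink_subset (hK : Convex ℝ 𝒦) (hr : 0 < r) (hball : Metric.closedBall 0 r ⊆ 𝒦)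
    (hδ : 0 < δ) (hδr : δ ≤ r) : shrink 𝒦 r δ ⊆ 𝒦 := fun x hx => by
  simpa using add_smul_mem_of_mem_shrink hK hr hball hδ hδr hx (v := 0) (by simp)

theorem isCompact_of_isClosed_of_subset (hcl : IsClosed 𝒦) (hR : 𝒦 ⊆ Metric.closedBall 0 R) :
    IsCompact 𝒦 := (isCompact_closedBall (0 : Euc d) R).of_isClosed_subset hcl hR

end Shrink

/-! ### Deterministic analysis of the block recursion -/

/-- The recursions of the blocks of the algorithm, numbered from zero, at a fixed outcome:
`X m j` is the point played, `Z m j` the dual variable and `B m j` the block gradient. -/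
structure IsBlockRun {n d : ℕ} (P : Matrix (Fin n) (Fin n) ℝ) (K : ℕ) (a : Euc d)
    (prox : Euc d → Euc d) (ε β : ℝ) (X Z B : ℕ → Fin n → Euc d) : Prop where
  X_zero : ∀ j, X 0 j = a
  Z_zero : ∀ j, Z 0 j = 0
  X_succ : ∀ m < K, ∀ j, ‖X (m + 1) j - prox (Z m j)‖ ≤ ε
  Z_succ : ∀ m < K, ∀ j, Z (m + 1) j = ∑ l, P j l • Z m l + B m j
  B_le : ∀ m < K, ∀ j, ‖B m j‖ ≤ β

namespace IsBlockRun

variable {n d : ℕ} {E : Fin n → Fin n → Prop} {P : Matrix (Fin n) (Fin n) ℝ} {K : ℕ}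
  {a : Euc d} {prox : Euc d → Euc d} {ε β h R : ℝ} {X Z B : ℕ → Fin n → Euc d} {S : Set (Euc d)}

/-- The point of block `m + 1` is computed from `Z m`, whose mean contains the first `m` block
gradients, while the leader of that block uses `m + 2` of them. The two missing means give `2 β`,
the consensus error gives the other dual term, and Lipschitz continuity of `prox` divides both by `2
h`. -/
theorem norm_sub_prox_le (H : IsBlockRun P K a prox ε β X Z B) (hP : IsGossipMatrix E P)
    (hprox : IsProx S h a prox) (hh : 0 < h) (ha : a ∈ S) (hε : 0 ≤ ε) (hβ : 0 ≤ β) {m : ℕ}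
    (hm : m < K) (j : Fin n) :
    ‖X m j - prox (∑ k ∈ Finset.range (m + 1), nodeMean (B k))‖ ≤
      ε + (√n * β / (1 - sigmaTwo P) + 2 * β) / (2 * h) := by
  have hσ : 0 < 1 - sigmaTwo P := by linarith [hP.sigmaTwo_lt_one]
  have hcons := fun {m} (hm : m ≤ K) => hP.norm_sub_nodeMean_le hβ H.B_le H.Z_zero H.Z_succ hm
  have hmean : ∀ k < K, ‖nodeMean (B k)‖ ≤ β := fun k hk => norm_nodeMean_le hβ (H.B_le k hk)
  have hb : 0 ≤ √n * β / (1 - sigmaTwo P) := by positivity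
  rcases m with _ | m
  · rw [H.X_zero, ← hprox.zero hh ha]
    have h1 := hprox.norm_sub_le hh 0 (∑ k ∈ Finset.range (0 + 1), nodeMean (B k))
    simp only [zero_add, Finset.range_one, Finset.sum_singleton, zero_sub, norm_neg] at h1 ⊢
    refine h1.trans ?_
    have : ‖nodeMean (B 0)‖ / (2 * h) ≤ (√n * β / (1 - sigmaTwo P) + 2 * β) / (2 * h) := by
      gcongr; linarith [hmean 0 hm]
    linarith
  · have h1 := H.X_succ m (by omega) j
    have h2 := hprox.norm_sub_le hh (Z m j) (∑ k ∈ Finset.range (m + 1 + 1), nodeMean (B k))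
    obtain ⟨havg, hdev⟩ := hcons (by omega : m ≤ K)
    have h3 : ‖Z m j - ∑ k ∈ Finset.range (m + 1 + 1), nodeMean (B k)‖ ≤
        √n * β / (1 - sigmaTwo P) + 2 * β := by
      rw [Finset.sum_range_succ, Finset.sum_range_succ, ← havg]
      have e : Z m j - (nodeMean (Z m) + nodeMean (B m) + nodeMean (B (m + 1))) =
          (Z m j - nodeMean (Z m)) - (nodeMean (B m) + nodeMean (B (m + 1))) := by abel
      rw [e]
      have h4 := norm_sub_le (Z m j - nodeMean (Z m)) (nodeMean (B m) + nodeMean (B (m + 1)))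
      have h5 := norm_add_le (nodeMean (B m)) (nodeMean (B (m + 1)))
      linarith [hdev j, hmean m (by omega), hmean (m + 1) hm]
    have h4 := norm_sub_le_norm_sub_add_norm_sub (X (m + 1) j) (prox (Z m j))
      (prox (∑ k ∈ Finset.range (m + 1 + 1), nodeMean (B k)))
    have h5 : ‖Z m j - ∑ k ∈ Finset.range (m + 1 + 1), nodeMean (B k)‖ / (2 * h) ≤
        (√n * β / (1 - sigmaTwo P) + 2 * β) / (2 * h) := by gcongr
    linarith

/-- Once each `X m j` is replaced by the leader, which is common to all nodes, only the mean block
gradient matters and the leader bound applies; the replacement costs `β D` per node and block. -/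
theorem sum_inner_le (H : IsBlockRun P K a prox ε β X Z B) (hprox : IsProx S h a prox)
    (hh : 0 < h) (ha : a ∈ S) (hSR : S ⊆ Metric.closedBall 0 R) (hβ : 0 ≤ β) {D : ℝ}
    (hD : ∀ m < K, ∀ j, ‖X m j - prox (∑ k ∈ Finset.range (m + 1), nodeMean (B k))‖ ≤ D)
    (i₀ : Fin n) {x : Euc d} (hx : x ∈ S) :
    ∑ m ∈ Finset.range K, ∑ j, ⟪B m j, X m j - x⟫ ≤ n * (K * (β * D) + 4 * h * R ^ 2) := by
  have hbtl := hprox.sum_inner_le hh.le hSR ha (fun k => nodeMean (B k)) hx K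
  set p : ℕ → Euc d := fun m => prox (∑ k ∈ Finset.range (m + 1), nodeMean (B k))
  have h1 : ∀ m ∈ Finset.range K, ∑ j, ⟪B m j, X m j - x⟫ ≤
      n * (β * D) + n * ⟪nodeMean (B m), p m - x⟫ := by
    intro m hm
    have hm := Finset.mem_range.1 hm
    have e : ∀ j, ⟪B m j, X m j - x⟫ = ⟪B m j, X m j - p m⟫ + ⟪B m j, p m - x⟫ := by
      intro j; rw [← inner_add_right]; congr 1; abel
    simp_rw [e, Finset.sum_add_distrib]
    have e2 : ∑ j, ⟪B m j, p m - x⟫ = n * ⟪nodeMean (B m), p m - x⟫ := by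
      rw [← sum_inner, sum_eq_smul_nodeMean i₀, inner_smul_left]; simp
    rw [e2]
    gcongr
    calc ∑ j, ⟪B m j, X m j - p m⟫ ≤ ∑ _j : Fin n, β * D := by
          refine Finset.sum_le_sum fun j _ => (real_inner_le_norm _ _).trans ?_
          exact mul_le_mul (H.B_le m hm j) (hD m hm j) (norm_nonneg _) hβ
      _ = n * (β * D) := by simp
  calc _ ≤ ∑ m ∈ Finset.range K, (n * (β * D) + n * ⟪nodeMean (B m), p m - x⟫) :=
        Finset.sum_le_sum h1
    _ = n * (K * (β * D) + ∑ m ∈ Finset.range K, ⟪nodeMean (B m), p m - x⟫) := by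
        rw [Finset.sum_add_distrib, Finset.sum_const, Finset.card_range, nsmul_eq_mul,
          ← Finset.mul_sum]
        ring
    _ ≤ _ := by gcongr

end IsBlockRun

/-! ### Regrouping rounds, the loss of one round and its noise -/

/-- A sum over `N * K` rounds, arranged by blocks of length `K`. -/
theorem sum_range_mul_eq {X : Type*} [AddCommMonoid X] (φ : ℕ → X) (N K : ℕ) :
    ∑ t ∈ Finset.range (N * K), φ t =
      ∑ m ∈ Finset.range N, ∑ k ∈ Finset.range K, φ (m * K + k) := by
  induction N with
  | zero => simp
  | succ N ih => rw [Nat.succ_mul, Finset.sum_range_add, ih, Finset.sum_range_succ]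

theorem sum_Icc_add_one {X : Type*} [AddCommMonoid X] (φ : ℕ → X) (s N : ℕ) :
    ∑ t ∈ Finset.Icc (s + 1) (s + N), φ t = ∑ k ∈ Finset.range N, φ (s + k + 1) := by
  have : Finset.Icc (s + 1) (s + N) = Finset.Ico (s + 1) (s + N + 1) := by ext; simp
  rw [this, Finset.sum_Ico_eq_sum_range]
  have e : s + N + 1 - (s + 1) = N := by omega
  rw [e]
  refine Finset.sum_congr rfl fun k _ => ?_
  congr 1; omega

/-- The losses of one round compared with a fixed point. -/
theorem loss_sub_le {n d : ℕ} (hd : 0 < d) {𝒦 : Set (Euc d)} {r δ R G D : ℝ} (hK : Convex ℝ 𝒦)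
    (hr : 0 < r) (hball : Metric.closedBall 0 r ⊆ 𝒦) (hKR : 𝒦 ⊆ Metric.closedBall 0 R)
    (hδ : 0 < δ) (hδr : δ ≤ r) (hG0 : 0 ≤ G) {F : Fin n → Euc d → ℝ}
    (hF : ∀ j, Continuous (F j)) (hconv : ∀ j, ConvexOn ℝ 𝒦 (F j))
    (hG : ∀ j, ∀ a ∈ 𝒦, ∀ b ∈ 𝒦, |F j a - F j b| ≤ G * ‖a - b‖) {X : Fin n → Euc d}
    (hX : ∀ j, X j ∈ shrink 𝒦 r δ) (i : Fin n) (hD : ∀ j, ‖X i - X j‖ ≤ D) {s : Euc d}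
    (hs : ‖s‖ ≤ 1) {x : Euc d} (hx : x ∈ 𝒦) (j : Fin n) :
    F j (X i + δ • s) - F j x ≤ ⟪gradMean (F j) δ (X j), X j - (1 - δ / r) • x⟫ +
      (G * D + 3 * (G * δ) + G * (δ * R / r)) := by
  have hmem : ∀ {y}, y ∈ shrink 𝒦 r δ → ∀ v : Euc d, ‖v‖ ≤ 1 → y + δ • v ∈ 𝒦 :=
    fun hy v hv => add_smul_mem_of_mem_shrink hK hr hball hδ hδr hy hv
  have hsub := shrink_subset hK hr hball hδ hδr
  have hx' : (1 - δ / r) • x ∈ shrink 𝒦 r δ := ⟨x, hx, rfl⟩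
  -- The four errors: smoothing `2 G δ`; the exploration step, `G δ`; passing from learner `i` to
  -- learner `j`, `G D`; shrinking the comparator, `G δ R / r`.
  have h1 := sub_le_inner_gradMean hd (hF j) (hconv j) hδ (hG j) hG0 (hmem (hX j)) (hmem hx')
  have h2 := (le_abs_self _).trans (hG j _ (hmem (hX i) s hs) _ (hsub (hX i)))
  have h3 := (le_abs_self _).trans (hG j _ (hsub (hX i)) _ (hsub (hX j)))
  have h4 := (le_abs_self _).trans (hG j _ (hsub hx') _ hx)
  have e2 : ‖X i + δ • s - X i‖ ≤ δ := by
    rw [add_sub_cancel_left, norm_smul, Real.norm_eq_abs, abs_of_pos hδ]; nlinarith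
  have e4 : ‖(1 - δ / r) • x - x‖ ≤ δ * R / r := by
    have : (1 - δ / r) • x - x = (-(δ / r)) • x := by module
    rw [this, norm_smul, norm_neg, Real.norm_eq_abs, abs_of_pos (by positivity)]
    have := mem_closedBall_zero_iff.1 (hKR hx)
    calc δ / r * ‖x‖ ≤ δ / r * R := by gcongr
      _ = _ := by ring
  have g2 := mul_le_mul_of_nonneg_left e2 hG0
  have g3 := mul_le_mul_of_nonneg_left (hD j) hG0
  have g4 := mul_le_mul_of_nonneg_left e4 hG0
  linarith

/-- Tail bound for the accumulated noise of the one-point gradient estimates, tested against a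
function of the current point. -/
theorem measure_noise_ge_le {Ω : Type*} [mΩ : MeasurableSpace Ω] {μ : Measure Ω}
    [IsProbabilityMeasure μ] {ℱ : Filtration ℕ mΩ} {n d : ℕ} (hd : 0 < d) {T : ℕ}
    {u : ℕ → Fin n → Ω → UnitSphere d} (hu : IsUniformSampling μ ℱ T u) {j : Fin n}
    {x : ℕ → Ω → Euc d} {F : ℕ → Euc d → ℝ} (hF : ∀ t, Continuous (F t)) {W : Euc d → Euc d}
    (hW : Measurable W) {δ M ρ : ℝ} (hδ : 0 < δ) (hM : 0 < M) (hρ : 0 < ρ) {t₀ N : ℕ}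
    (hN : 0 < N) (hT : t₀ + N ≤ T)
    (hx : ∀ t, t₀ ≤ t → t < t₀ + N → Measurable[ℱ t] (x t))
    (hFM : ∀ t, t₀ ≤ t → t < t₀ + N → ∀ ω, ∀ s : UnitSphere d,
      |F (t + 1) (x t ω + δ • (s : Euc d))| ≤ M)
    (hWρ : ∀ t, t₀ ≤ t → t < t₀ + N → ∀ ω, ‖W (x t ω)‖ ≤ ρ) {ε : ℝ} (hε : 0 ≤ ε) :
    μ {ω | ε ≤ ∑ k ∈ Finset.range N, ⟪gradMean (F (t₀ + k + 1)) δ (x (t₀ + k) ω) -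
        gradEstimate (F (t₀ + k + 1)) δ (x (t₀ + k) ω) (u (t₀ + k + 1) j ω),
          W (x (t₀ + k) ω)⟫} ≤
      ENNReal.ofReal (Real.exp (-ε ^ 2 / (2 * N * (2 * (d / δ * M) * ρ) ^ 2))) := by
  have := isProbabilityMeasure_uniformSphere hd
  have hIcc : ∀ t, t < t₀ + N → t + 1 ∈ Finset.Icc 1 T := fun t ht =>
    Finset.mem_Icc.2 ⟨by omega, by omega⟩
  refine measure_sum_ge_le_exp (ν := uniformSphere d) (ℱ := ℱ) (u := fun t => u t j)
    (φ := fun t p => ⟪gradMean (F (t + 1)) δ p.1 - gradEstimate (F (t + 1)) δ p.1 p.2, W p.1⟫)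
    (by positivity) hN ?_ hx ?_ ?_ ?_ ?_ ?_ hε
  · intro t _ _
    have h1 : Measurable fun p : Euc d × UnitSphere d => gradMean (F (t + 1)) δ p.1 :=
      (measurable_gradMean hd (hF _) δ).comp measurable_fst
    exact (h1.sub (continuous_gradEstimate (hF _) δ).measurable).inner (hW.comp measurable_fst)
  · exact fun t _ ht => hu.adapted _ (hIcc t ht) j
  · exact fun t _ ht => (hu.uniform _ (hIcc t ht) j).map_eq
  · intro t _ ht
    refine indep_of_indep_of_le_left (hu.indep_past t (by omega)) ?_
    have : u (t + 1) j = (fun f : Fin n → UnitSphere d => f j) ∘ fun ω i => u (t + 1) i ω := rfl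
    rw [this, ← MeasurableSpace.comap_comp]
    exact MeasurableSpace.comap_mono (measurable_pi_apply j).comap_le
  · intro t h1 h2 ω s
    have hest : ∀ s, ‖gradEstimate (F (t + 1)) δ (x t ω) s‖ ≤ d / δ * M := fun s =>
      norm_gradEstimate_le hδ (hFM t h1 h2 ω s)
    have hmean : ‖gradMean (F (t + 1)) δ (x t ω)‖ ≤ d / δ * M :=
      (norm_integral_le_of_norm_le_const (Eventually.of_forall hest)).trans (by simp)
    refine (abs_real_inner_le_norm _ _).trans
      (mul_le_mul ((norm_sub_le _ _).trans ?_) (hWρ t h1 h2 ω) (norm_nonneg _) (by positivity))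
    linarith [hest s]
  · intro t h1 h2 ω
    have hint := integrable_gradEstimate hd (hF (t + 1)) δ (x t ω)
    simp_rw [inner_sub_left]
    rw [integral_sub (integrable_const _) (hint.inner_const _), integral_const,
      ← inner_gradMean hd (hF _)]
    simp

/-! ### Feasibility and predictability of the iterates -/

namespace DBBCGRun

variable {n d : ℕ} {Ω : Type*} {E : Fin n → Fin n → Prop}
    {P : Matrix (Fin n) (Fin n) ℝ} {f : ℕ → Fin n → Euc d → ℝ} {𝒦 : Set (Euc d)} {r δ : ℝ}
    {xin : Euc d} {α h : ℝ} {L K T : ℕ} {u : ℕ → Fin n → Ω → UnitSphere d}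

theorem x_mem (A : DBBCGRun E P f 𝒦 r δ xin α h L K T u) (hS : Convex ℝ (shrink 𝒦 r δ))
    (hxin : xin ∈ shrink 𝒦 r δ) {m : ℕ} (hm : m ≤ T / K) (i : Fin n) (ω : Ω) :
    A.x (m + 1) i ω ∈ shrink 𝒦 r δ := by
  induction m with
  | zero => rwa [zero_add, A.x_one]
  | succ m ih =>
    have hrun := A.x_succ (m + 1) (Finset.mem_Icc.2 ⟨by omega, hm⟩) i ω
    rw [← hrun.output]
    exact hrun.mem hS (ih (by omega)) L le_rfl

/-- The iterates are algebraic expressions in the selected minimizers and step sizes. The point of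
block `m + 1` is thus known after round `m K`, before that block draws any direction. -/
theorem x_measurable [mΩ : MeasurableSpace Ω] (A : DBBCGRun E P f 𝒦 r δ xin α h L K T u) {ℱ : Filtration ℕ mΩ}
    (hA : A.IsCausal ℱ) {m : ℕ} (hm : m ≤ T / K) (i : Fin n) :
    Measurable[ℱ (m * K)] (A.x (m + 1) i) := by
  induction m with
  | zero =>
    have : A.x (0 + 1) i = fun _ => xin := by ext1 ω; exact A.x_one i ω
    rw [this]; exact measurable_const
  | succ m ih =>
    have hm' : m + 1 ∈ Finset.Icc 1 (T / K) := Finset.mem_Icc.2 ⟨by omega, hm⟩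
    have hrun := A.x_succ (m + 1) hm' i
    have hc : ∀ τ ≤ L, Measurable[ℱ ((m + 1) * K)] (A.c (m + 1) i τ) := by
      intro τ
      induction τ with
      | zero =>
        intro _
        have : A.c (m + 1) i 0 = A.x (m + 1) i := by ext1 ω; exact (hrun ω).init
        rw [this]
        exact (ih (by omega)).mono (ℱ.mono (Nat.mul_le_mul_right _ (by omega))) le_rfl
      | succ τ ihτ =>
        intro hτ
        have : A.c (m + 1) i (τ + 1) = fun ω => A.c (m + 1) i τ ω +
            A.s (m + 1) i τ ω • (A.v (m + 1) i τ ω - A.c (m + 1) i τ ω) := by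
          ext1 ω; exact (hrun ω).next τ hτ
        rw [this]
        obtain ⟨hv, hs⟩ := hA (m + 1) hm' i τ hτ
        exact (ihτ (by omega)).add (hs.smul (hv.sub (ihτ (by omega))))
    have : A.x (m + 1 + 1) i = A.c (m + 1) i L := by ext1 ω; exact (hrun ω).output.symm
    rw [this]
    exact hc L le_rfl

end DBBCGRun

/-! ### Tail probabilities and tools for the union bounds -/

theorem one_le_xi (n T : ℕ) (γ : ℝ) : 1 ≤ xi n T γ := by
  unfold xi; linarith [Real.sqrt_nonneg (8 * Real.log (n * √(T : ℝ) / γ))]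

/-- Since `ξ² ≥ 1 + 8 log (n K / γ)`, the logarithm pays for a union over learners and blocks, and
the summand `1` leaves `exp (-a)`, which later pays for coordinates and signs. -/
theorem exp_neg_mul_xi_sq_le {n T K : ℕ} {γ : ℝ} (hn : 0 < n) (hK : 0 < K)
    (hKT : (K : ℝ) = √(T : ℝ)) (hγ : 0 < γ) (hγ1 : γ < 1 / 2) {a : ℝ} (ha : 1 / 2 ≤ a) :
    Real.exp (-(a * xi n T γ ^ 2)) ≤ Real.exp (-a) * (γ / (n * K)) := by
  have hn1 : (1 : ℝ) ≤ n := by exact_mod_cast hn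
  have hK1 : (1 : ℝ) ≤ K := by exact_mod_cast hK
  set y : ℝ := n * K / γ with hy
  have hy1 : 1 ≤ y := by
    rw [hy, le_div_iff₀ hγ]; nlinarith
  have hlog : 0 ≤ Real.log y := Real.log_nonneg hy1
  have hxi : xi n T γ = 1 + √(8 * Real.log y) := by rw [xi, ← hKT]
  have hsq : 1 + 8 * Real.log y ≤ xi n T γ ^ 2 := by
    rw [hxi]
    have h1 := Real.sq_sqrt (by positivity : 0 ≤ 8 * Real.log y)
    nlinarith [Real.sqrt_nonneg (8 * Real.log y)]
  have hyi : γ / (n * K) = Real.exp (-Real.log y) := by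
    rw [Real.exp_neg, Real.exp_log (by linarith), hy, inv_div]
  rw [hyi, ← Real.exp_add]
  refine Real.exp_le_exp.2 ?_
  nlinarith

theorem ofReal_one_sub_le_measure {Ω : Type*} [MeasurableSpace Ω] {μ : Measure Ω}
    [IsProbabilityMeasure μ] {A B₁ B₂ : Set Ω} {γ : ℝ} (hγ : 0 ≤ γ)
    (h : ∀ ω, ω ∉ B₁ → ω ∉ B₂ → ω ∈ A) (h₁ : μ B₁ ≤ ENNReal.ofReal γ)
    (h₂ : μ B₂ ≤ ENNReal.ofReal γ) : ENNReal.ofReal (1 - 2 * γ) ≤ μ A := by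
  have hcov : (univ : Set Ω) ⊆ A ∪ (B₁ ∪ B₂) := by
    intro ω _
    by_contra hcon
    simp only [mem_union, not_or] at hcon
    exact hcon.1 (h ω hcon.2.1 hcon.2.2)
  have h1 : 1 ≤ μ A + (ENNReal.ofReal γ + ENNReal.ofReal γ) := by
    calc 1 = μ univ := measure_univ.symm
      _ ≤ μ A + (μ B₁ + μ B₂) := (measure_mono hcov).trans
          ((measure_union_le _ _).trans (by gcongr; exact measure_union_le _ _))
      _ ≤ _ := by gcongr
  rw [ENNReal.ofReal_sub _ (by positivity), ENNReal.ofReal_one, tsub_le_iff_right, two_mul,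
    ENNReal.ofReal_add hγ hγ]
  exact h1

/-- Testing against both signs of each basis vector reduces a norm bound to `2 d` one-sided scalar
bounds, the form that the tail inequality supplies. -/
theorem EuclideanSpace.norm_le_sqrt_mul {d : ℕ} {v : Euc d} {ε : ℝ} (hε : 0 ≤ ε)
    (h : ∀ l, ∀ b : Bool, ⟪v, (if b then (1 : ℝ) else -1) • EuclideanSpace.single l (1 : ℝ)⟫ ≤ ε) :
    ‖v‖ ≤ √d * ε := by
  refine le_of_sq_le_sq ?_ (by positivity)
  rw [EuclideanSpace.real_norm_sq_eq, mul_pow, Real.sq_sqrt (Nat.cast_nonneg d)]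
  calc ∑ l, v l ^ 2 ≤ ∑ _l : Fin d, ε ^ 2 := by
        refine Finset.sum_le_sum fun l _ => ?_
        have h1 := h l true
        have h2 := h l false
        simp [EuclideanSpace.inner_single_right] at h1 h2
        nlinarith
    _ = d * ε ^ 2 := by simp

theorem IsGossipMatrix.sum_neighbors {n d : ℕ} {E : Fin n → Fin n → Prop}
    {P : Matrix (Fin n) (Fin n) ℝ} (hP : IsGossipMatrix E P) (i : Fin n) (z : Fin n → Euc d) :
    ∑ j ∈ neighbors E i, P i j • z j = ∑ j, P i j • z j := by
  refine Finset.sum_subset (Finset.subset_univ _) fun j _ hj => ?_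
  have hE : ¬ E i j := by simpa [neighbors] using hj
  have h0 : 0 ≤ P i j := nonneg_of_mem_doublyStochastic hP.doublyStochastic
  have : P i j = 0 := le_antisymm (not_lt.1 fun h => hE (hP.support i j h)) h0
  rw [this, zero_smul]

/-! ### Regret on the good events -/

namespace DBBCGRun

variable {n d : ℕ} {Ω : Type*} {E : Fin n → Fin n → Prop}
    {P : Matrix (Fin n) (Fin n) ℝ} {f : ℕ → Fin n → Euc d → ℝ} {𝒦 : Set (Euc d)} {r δ : ℝ}
    {xin : Euc d} {h : ℝ} {K : ℕ} {u : ℕ → Fin n → Ω → UnitSphere d}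

theorem y_eq_add (A : DBBCGRun E P f 𝒦 r δ xin 0 h K K (K * K) u) (hK : 0 < K) {m k : ℕ}
    (hm : m < K) (hk : k < K) (i : Fin n) (ω : Ω) :
    A.y (m * K + k + 1) i ω = A.x (m + 1) i ω + δ • (u (m * K + k + 1) i ω : Euc d) := by
  refine A.y_eq (m + 1) ?_ _ ?_ i ω
  · rw [Nat.mul_div_cancel _ hK]; exact Finset.mem_Icc.2 ⟨by omega, by omega⟩
  · rw [blockRounds, Finset.mem_Icc, Nat.add_sub_cancel, Nat.succ_mul]
    constructor <;> omega

theorem gHat_eq_sum (A : DBBCGRun E P f 𝒦 r δ xin 0 h K K (K * K) u) (hK : 0 < K) {m : ℕ}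
    (hm : m < K) (i : Fin n) (ω : Ω) :
    A.gHat (m + 1) i ω = ∑ k ∈ Finset.range K, A.g (m * K + k + 1) i ω := by
  rw [A.gHat_eq (m + 1) (by
    rw [Nat.mul_div_cancel _ hK]; exact Finset.mem_Icc.2 ⟨by omega, by omega⟩), blockRounds,
    Nat.add_sub_cancel, Nat.succ_mul, sum_Icc_add_one (fun t => A.g t i ω)]

theorem round_mem {K m k : ℕ} (hm : m < K) (hk : k < K) :
    m * K + k + 1 ∈ Finset.Icc 1 (K * K) := by
  rw [Finset.mem_Icc]
  have : (m + 1) * K ≤ K * K := Nat.mul_le_mul_right _ hm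
  rw [Nat.succ_mul] at this
  omega

theorem g_eq_gradEstimate (A : DBBCGRun E P f 𝒦 r δ xin 0 h K K (K * K) u) (hK : 0 < K)
    (hconv : Convex ℝ 𝒦) (hr : 0 < r) (hball : Metric.closedBall 0 r ⊆ 𝒦) (hδ : 0 < δ)
    (hδr : δ ≤ r) (hxin : xin ∈ shrink 𝒦 r δ) {F : ℕ → Fin n → Euc d → ℝ}
    (hF : ∀ t ∈ Finset.Icc 1 (K * K), ∀ j, EqOn (f t j) (F t j) 𝒦) {m k : ℕ}
    (hm : m < K) (hk : k < K) (i : Fin n) (ω : Ω) :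
    A.g (m * K + k + 1) i ω =
      gradEstimate (F (m * K + k + 1) i) δ (A.x (m + 1) i ω) (u (m * K + k + 1) i ω) := by
  rw [A.g_eq _ (round_mem hm hk), gradEstimate, A.y_eq_add hK hm hk, hF _ (round_mem hm hk)]
  have hx := A.x_mem (hconv.smul _) hxin (m := m) (by rw [Nat.mul_div_cancel _ hK]; omega) i ω
  exact add_smul_mem_of_mem_shrink hconv hr hball hδ hδr hx (norm_coe_unitSphere _).le

/-- The regret of a run whose block gradients and accumulated noise are bounded. -/
theorem regret_le_of_bounds (hd : 0 < d) {R G β η : ℝ} (hR : 0 < R) (hG0 : 0 ≤ G) (hβ : 0 ≤ β)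
    (A : DBBCGRun E P f 𝒦 r δ xin 0 h K K (K * K) u) (hK : 0 < K) (hh : 0 < h)
    (hP : IsGossipMatrix E P) (hconv : Convex ℝ 𝒦) (hcl : IsClosed 𝒦) (hr : 0 < r)
    (hball : Metric.closedBall 0 r ⊆ 𝒦) (hKR : 𝒦 ⊆ Metric.closedBall 0 R) (hδ : 0 < δ)
    (hδr : δ ≤ r) (hxin : xin ∈ shrink 𝒦 r δ) {F : ℕ → Fin n → Euc d → ℝ}
    (hF : ∀ t ∈ Finset.Icc 1 (K * K), ∀ j, EqOn (f t j) (F t j) 𝒦)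
    (hFc : ∀ t j, Continuous (F t j))
    (hfc : ∀ t ∈ Finset.Icc 1 (K * K), ∀ i, ConvexOn ℝ 𝒦 (f t i))
    (hfG : ∀ t ∈ Finset.Icc 1 (K * K), ∀ i, ∀ x ∈ 𝒦, ∀ y ∈ 𝒦,
      |f t i x - f t i y| ≤ G * ‖x - y‖) (ω : Ω)
    (hgHat : ∀ m < K, ∀ j, ‖A.gHat (m + 1) j ω‖ ≤ β) {x : Euc d} (hx : x ∈ 𝒦)
    (hnoise : ∀ j, ∑ m ∈ Finset.range K, ∑ k ∈ Finset.range K,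
      ⟪gradMean (F (m * K + k + 1) j) δ (A.x (m + 1) j ω) - A.g (m * K + k + 1) j ω,
        A.x (m + 1) j ω - (1 - δ / r) • x⟫ ≤ η) (i : Fin n) {D : ℝ}
    (hD : 4 * R / √K + (√n * β / (1 - sigmaTwo P) + 2 * β) / (2 * h) = D) :
    ∑ t ∈ Finset.Icc 1 (K * K), ∑ j, f t j (A.y t i ω) -
      ∑ t ∈ Finset.Icc 1 (K * K), ∑ j, f t j x ≤
    n * (K * K * (G * (2 * D) + 3 * (G * δ) + G * (δ * R / r)) + η +
      (K * (β * D) + 4 * h * R ^ 2)) := by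
  set S := shrink 𝒦 r δ with hSdef
  have hSconv : Convex ℝ S := hconv.smul _
  have hScomp : IsCompact S := (isCompact_of_isClosed_of_subset hcl hKR).smul _
  have hSsub : S ⊆ 𝒦 := shrink_subset hconv hr hball hδ hδr
  have hSR : S ⊆ Metric.closedBall 0 R := hSsub.trans hKR
  obtain ⟨prox, hprox⟩ := exists_isProx hSconv hScomp ⟨xin, hxin⟩ h xin
  have hdiv : K * K / K = K := Nat.mul_div_cancel _ hK
  have hmem : ∀ m ≤ K, ∀ j, A.x (m + 1) j ω ∈ S := fun m hm j =>
    A.x_mem hSconv hxin (by rwa [hdiv]) j ω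
  have hrun : IsBlockRun P K xin prox (4 * R / √K) β (fun m j => A.x (m + 1) j ω)
      (fun m j => A.z (m + 1) j ω) (fun m j => A.gHat (m + 1) j ω) := by
    refine ⟨fun j => A.x_one j ω, fun j => A.z_one j ω, ?_, ?_, hgHat⟩
    · intro m hm j
      have hcg := A.x_succ (m + 1) (Finset.mem_Icc.2 ⟨by omega, by rw [hdiv]; omega⟩) j ω
      rw [surrogate_zero] at hcg
      exact hprox.norm_cg_sub_le hSconv hR.le hSR hh hK (hmem m hm.le j) hcg
    · intro m hm j
      have hz := A.z_succ (m + 1) (Finset.mem_Icc.2 ⟨by omega, by rw [hdiv]; omega⟩) j ω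
      rw [hP.sum_neighbors j (fun l => A.z (m + 1) l ω)] at hz
      simpa using hz
  have hdist : ∀ m < K, ∀ j, ‖A.x (m + 1) j ω -
      prox (∑ k ∈ Finset.range (m + 1), nodeMean (fun j => A.gHat (k + 1) j ω))‖ ≤ D := by
    intro m hm j
    rw [← hD]
    exact hrun.norm_sub_prox_le hP hprox hh hxin (by positivity) hβ hm j
  have hlin := hrun.sum_inner_le hprox hh hxin hSR hβ hdist i
    (show (1 - δ / r) • x ∈ S from ⟨x, hx, rfl⟩)
  -- Any two learners are compared through their common leader.
  have hpair : ∀ m < K, ∀ j, ‖A.x (m + 1) i ω - A.x (m + 1) j ω‖ ≤ 2 * D := by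
    intro m hm j
    have h1 := norm_sub_le_norm_sub_add_norm_sub (A.x (m + 1) i ω)
      (prox (∑ k ∈ Finset.range (m + 1), nodeMean (fun j => A.gHat (k + 1) j ω)))
      (A.x (m + 1) j ω)
    have h2 := hdist m hm j
    rw [norm_sub_rev] at h2
    linarith [hdist m hm i]
  set q : ℝ := G * (2 * D) + 3 * (G * δ) + G * (δ * R / r)
  have hround : ∀ m < K, ∀ k < K, ∀ j,
      f (m * K + k + 1) j (A.y (m * K + k + 1) i ω) - f (m * K + k + 1) j x ≤
      ⟪gradMean (F (m * K + k + 1) j) δ (A.x (m + 1) j ω) - A.g (m * K + k + 1) j ω,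
        A.x (m + 1) j ω - (1 - δ / r) • x⟫ +
      ⟪A.g (m * K + k + 1) j ω, A.x (m + 1) j ω - (1 - δ / r) • x⟫ + q := by
    intro m hm k hk j
    have ht := round_mem hm hk
    have hy : A.y (m * K + k + 1) i ω ∈ 𝒦 := by
      rw [A.y_eq_add hK hm hk]
      exact add_smul_mem_of_mem_shrink hconv hr hball hδ hδr (hmem m hm.le i)
        (norm_coe_unitSphere _).le
    rw [hF _ ht j hy, hF _ ht j hx, A.y_eq_add hK hm hk, ← inner_add_left, sub_add_cancel]
    exact loss_sub_le hd hconv hr hball hKR hδ hδr hG0 (fun j => hFc _ j)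
      (fun j => (hfc _ ht j).congr (hF _ ht j))
      (fun j a ha b hb => by rw [← hF _ ht j ha, ← hF _ ht j hb]; exact hfG _ ht j a ha b hb)
      (X := fun j => A.x (m + 1) j ω) (fun j => hmem m hm.le j) i (hpair m hm)
      (norm_coe_unitSphere _).le hx j
  have hsplit : ∀ φ : ℕ → ℝ, ∑ t ∈ Finset.Icc 1 (K * K), φ t =
      ∑ m ∈ Finset.range K, ∑ k ∈ Finset.range K, φ (m * K + k + 1) := by
    intro φ
    have := sum_Icc_add_one φ 0 (K * K)
    simp only [zero_add] at this
    rw [this, sum_range_mul_eq (fun t => φ (t + 1))]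
  have hnoise' : ∑ m ∈ Finset.range K, ∑ k ∈ Finset.range K, ∑ j,
      ⟪gradMean (F (m * K + k + 1) j) δ (A.x (m + 1) j ω) - A.g (m * K + k + 1) j ω,
        A.x (m + 1) j ω - (1 - δ / r) • x⟫ ≤ n * η := by
    have e : ∀ m, ∑ k ∈ Finset.range K, ∑ j,
      ⟪gradMean (F (m * K + k + 1) j) δ (A.x (m + 1) j ω) - A.g (m * K + k + 1) j ω,
        A.x (m + 1) j ω - (1 - δ / r) • x⟫ = ∑ j, ∑ k ∈ Finset.range K,
      ⟪gradMean (F (m * K + k + 1) j) δ (A.x (m + 1) j ω) - A.g (m * K + k + 1) j ω,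
        A.x (m + 1) j ω - (1 - δ / r) • x⟫ := fun m => Finset.sum_comm
    simp_rw [e]
    rw [Finset.sum_comm]
    exact (Finset.sum_le_sum fun j _ => hnoise j).trans (by simp)
  have hlin' : ∑ m ∈ Finset.range K, ∑ k ∈ Finset.range K, ∑ j,
      ⟪A.g (m * K + k + 1) j ω, A.x (m + 1) j ω - (1 - δ / r) • x⟫ ≤
      n * (K * (β * D) + 4 * h * R ^ 2) := by
    refine le_trans (le_of_eq ?_) hlin
    refine Finset.sum_congr rfl fun m hm => ?_
    rw [Finset.sum_comm]
    refine Finset.sum_congr rfl fun j _ => ?_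
    rw [← sum_inner, A.gHat_eq_sum hK (Finset.mem_range.1 hm)]
  rw [← Finset.sum_sub_distrib]
  simp_rw [← Finset.sum_sub_distrib]
  rw [hsplit]
  calc _ ≤ ∑ m ∈ Finset.range K, ∑ k ∈ Finset.range K, ∑ j : Fin n,
        (⟪gradMean (F (m * K + k + 1) j) δ (A.x (m + 1) j ω) - A.g (m * K + k + 1) j ω,
          A.x (m + 1) j ω - (1 - δ / r) • x⟫ +
        ⟪A.g (m * K + k + 1) j ω, A.x (m + 1) j ω - (1 - δ / r) • x⟫ + q) :=
        Finset.sum_le_sum fun m hm => Finset.sum_le_sum fun k hk => Finset.sum_le_sum fun j _ =>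
          hround m (Finset.mem_range.1 hm) k (Finset.mem_range.1 hk) j
    _ ≤ n * η + n * (K * (β * D) + 4 * h * R ^ 2) + n * (K * K * q) := by
        simp_rw [Finset.sum_add_distrib]
        refine add_le_add (add_le_add hnoise' hlin') (le_of_eq ?_)
        simp only [Finset.sum_const, Finset.card_univ, Fintype.card_fin, Finset.card_range,
          nsmul_eq_mul]
        ring
    _ = _ := by ring

end DBBCGRun

/-- The bound of `DBBCGRun.regret_le_of_bounds` for the parameters of the algorithm. -/
theorem regret_bound_arith {G M r R c β₀ K ξ θ δ h D : ℝ} (hG : 0 ≤ G) (hM : 0 < M)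
    (hr : 0 < r) (hR : 0 < R) (hc : 0 < c) (hβ₀ : 0 ≤ β₀) (hK : 0 < K) (hξ : 1 ≤ ξ)
    (hθ : 1 ≤ θ) (hδ : δ = c / √K) (hh : h = θ * ξ * M * (K * √K) / R)
    (hD : 4 * R / √K + (θ ^ 2 * (β₀ * ξ * K) + 2 * (β₀ * ξ * K)) / (2 * h) = D) :
    K * K * (G * (2 * D) + 3 * (G * δ) + G * (δ * R / r)) + 4 * (M / δ) * R * K * ξ +
      (K * ((β₀ * ξ * K) * D) + 4 * h * R ^ 2) ≤
    (2 * G * (4 * R + 3 * β₀ * R / (2 * M)) + 3 * G * c + G * c * R / r + 4 * M * R / c +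
      β₀ * (4 * R + 3 * β₀ * R / (2 * M)) + 4 * M * R) * (θ * (K * √K) * ξ) := by
  have hs : 0 < √K := Real.sqrt_pos.2 hK
  set s := √K with hsdef
  have hKs : K = s ^ 2 := (Real.sq_sqrt hK.le).symm
  have hξ0 : 0 < ξ := by linarith
  have hθ0 : 0 < θ := by linarith
  set C₂ := 4 * R + 3 * β₀ * R / (2 * M) with hC₂
  have hC₂0 : 0 ≤ C₂ := by positivity
  have hDle : D ≤ C₂ * θ / s := by
    -- Here the choice of `h` balances: one factor `θ` of the consensus error `θ²` is absorbed by
    -- `h`, and the other is the price of the regularizer.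
    have e1 : (θ ^ 2 * (β₀ * ξ * K) + 2 * (β₀ * ξ * K)) / (2 * h) =
        (θ + 2 / θ) * (β₀ * R / (2 * M)) / s := by
      rw [hh, hKs]; field_simp
    have e2 : θ + 2 / θ ≤ 3 * θ := by
      have : 2 / θ ≤ 2 * θ := by rw [div_le_iff₀ hθ0]; nlinarith
      linarith
    have e3 : (θ + 2 / θ) * (β₀ * R / (2 * M)) / s ≤ 3 * θ * (β₀ * R / (2 * M)) / s := by gcongr
    have e4 : 4 * R / s ≤ 4 * R * θ / s :=
      div_le_div_of_nonneg_right (le_mul_of_one_le_right (by positivity) hθ) hs.le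
    rw [← hD, e1]
    calc _ ≤ 4 * R * θ / s + 3 * θ * (β₀ * R / (2 * M)) / s := add_le_add e4 e3
      _ = C₂ * θ / s := by rw [hC₂]; ring
  have hθξ : 1 ≤ θ * ξ := by nlinarith
  have hs3 : 0 < s ^ 3 := by positivity
  have hKsq : K * K = s ^ 4 := by rw [hKs]; ring
  have hKs3 : K * s = s ^ 3 := by rw [hKs]; ring
  have t1 : K * K * (G * (2 * D)) ≤ 2 * G * C₂ * (θ * s ^ 3 * ξ) := by
    calc K * K * (G * (2 * D)) ≤ K * K * (G * (2 * (C₂ * θ / s))) := by gcongr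
      _ = 2 * G * C₂ * (θ * s ^ 3 * 1) := by rw [hKsq]; field_simp
      _ ≤ _ := by gcongr
  have t2 : K * K * (3 * (G * δ)) ≤ 3 * G * c * (θ * s ^ 3 * ξ) := by
    calc K * K * (3 * (G * δ)) = 3 * G * c * (s ^ 3 * 1) := by rw [hKsq, hδ]; field_simp
      _ ≤ 3 * G * c * (s ^ 3 * (θ * ξ)) := by gcongr
      _ = _ := by ring
  have t3 : K * K * (G * (δ * R / r)) ≤ G * c * R / r * (θ * s ^ 3 * ξ) := by
    calc K * K * (G * (δ * R / r)) = G * c * R / r * (s ^ 3 * 1) := by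
          rw [hKsq, hδ]; field_simp
      _ ≤ G * c * R / r * (s ^ 3 * (θ * ξ)) := by gcongr
      _ = _ := by ring
  have t4 : 4 * (M / δ) * R * K * ξ ≤ 4 * M * R / c * (θ * s ^ 3 * ξ) := by
    calc 4 * (M / δ) * R * K * ξ = 4 * M * R / c * (1 * s ^ 3 * ξ) := by
          rw [hKs, hδ]; field_simp
      _ ≤ _ := by gcongr
  have t5 : K * ((β₀ * ξ * K) * D) ≤ β₀ * C₂ * (θ * s ^ 3 * ξ) := by
    calc K * ((β₀ * ξ * K) * D) ≤ K * ((β₀ * ξ * K) * (C₂ * θ / s)) := by gcongr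
      _ = _ := by rw [hKs]; field_simp
  have t6 : 4 * h * R ^ 2 = 4 * M * R * (θ * s ^ 3 * ξ) := by
    rw [hh, hKs3]; field_simp
  rw [hKs3]
  linarith

/-! ### Probability of the good events -/

namespace DBBCGRun

variable {n d : ℕ} {Ω : Type*} [mΩ : MeasurableSpace Ω] {μ : Measure Ω} [IsProbabilityMeasure μ]
    {ℱ : Filtration ℕ mΩ} {E : Fin n → Fin n → Prop}
    {P : Matrix (Fin n) (Fin n) ℝ} {f : ℕ → Fin n → Euc d → ℝ} {𝒦 : Set (Euc d)} {r δ : ℝ}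
    {xin : Euc d} {h : ℝ} {K : ℕ} {u : ℕ → Fin n → Ω → UnitSphere d}

/-- The state is constant throughout the block and known at its start, so the increments are centred
given the past; the test vector is fixed. -/
theorem measure_block_noise_ge_le (A : DBBCGRun E P f 𝒦 r δ xin 0 h K K (K * K) u)
    (hd : 0 < d) (hu : IsUniformSampling μ ℱ (K * K) u) (hA : A.IsCausal ℱ) (hK : 0 < K)
    (hconv : Convex ℝ 𝒦) (hr : 0 < r) (hball : Metric.closedBall 0 r ⊆ 𝒦) (hδ : 0 < δ)
    (hδr : δ ≤ r) (hxin : xin ∈ shrink 𝒦 r δ) {F : ℕ → Fin n → Euc d → ℝ}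
    (hF : ∀ t ∈ Finset.Icc 1 (K * K), ∀ j, EqOn (f t j) (F t j) 𝒦)
    (hFc : ∀ t j, Continuous (F t j)) {M : ℝ} (hM : 0 < M)
    (hfM : ∀ t ∈ Finset.Icc 1 (K * K), ∀ i, ∀ x ∈ 𝒦, |f t i x| ≤ M)
    {m : ℕ} (hm : m < K) (j : Fin n) {w : Euc d} (hw : ‖w‖ ≤ 1) {ε : ℝ} (hε : 0 ≤ ε) :
    μ {ω | ε ≤ ∑ k ∈ Finset.range K,
      ⟪gradMean (F (m * K + k + 1) j) δ (A.x (m + 1) j ω) - A.g (m * K + k + 1) j ω, w⟫} ≤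
      ENNReal.ofReal (Real.exp (-ε ^ 2 / (2 * K * (2 * (d / δ * M)) ^ 2))) := by
  have hdiv : K * K / K = K := Nat.mul_div_cancel _ hK
  have hmK : m * K + K ≤ K * K := by
    have : (m + 1) * K ≤ K * K := Nat.mul_le_mul_right _ hm
    rwa [Nat.succ_mul] at this
  have key := measure_noise_ge_le hd hu (j := j) (x := fun _ => A.x (m + 1) j)
    (F := fun t => F t j) (fun t => hFc t j) (W := fun _ => w) measurable_const hδ hM one_pos
    (t₀ := m * K) hK hmK
    (fun t ht _ => (A.x_measurable hA (by omega) j).mono (ℱ.mono ht) le_rfl)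
    (fun t h1 h2 ω s => by
      have ht : t + 1 ∈ Finset.Icc 1 (K * K) := Finset.mem_Icc.2 ⟨by omega, by omega⟩
      have hx := A.x_mem (hconv.smul _) hxin (m := m) (by omega) j ω
      have hmem := add_smul_mem_of_mem_shrink hconv hr hball hδ hδr hx (norm_coe_unitSphere s).le
      rw [← hF _ ht j hmem]
      exact hfM _ ht j _ hmem)
    (fun _ _ _ _ => hw) hε
  rw [mul_one] at key
  refine le_trans (le_of_eq ?_) key
  congr 1
  ext ω
  simp only [mem_ofPred_eq]
  refine iff_of_eq (congrArg _ (Finset.sum_congr rfl fun k hk => ?_))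
  rw [A.g_eq_gradEstimate hK hconv hr hball hδ hδr hxin hF hm (Finset.mem_range.1 hk)]

/-- Here the test vector is random, but it is known before the round: round `t + 1` lies in block `t
/ K + 1`, whose point is known after round `(t / K) K ≤ t`. -/
theorem measure_total_noise_ge_le (A : DBBCGRun E P f 𝒦 r δ xin 0 h K K (K * K) u)
    (hd : 0 < d) (hu : IsUniformSampling μ ℱ (K * K) u) (hA : A.IsCausal ℱ) (hK : 0 < K)
    (hconv : Convex ℝ 𝒦) (hr : 0 < r) (hball : Metric.closedBall 0 r ⊆ 𝒦) {R : ℝ} (hR : 0 < R)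
    (hKR : 𝒦 ⊆ Metric.closedBall 0 R) (hδ : 0 < δ)
    (hδr : δ ≤ r) (hxin : xin ∈ shrink 𝒦 r δ) {F : ℕ → Fin n → Euc d → ℝ}
    (hF : ∀ t ∈ Finset.Icc 1 (K * K), ∀ j, EqOn (f t j) (F t j) 𝒦)
    (hFc : ∀ t j, Continuous (F t j)) {M : ℝ} (hM : 0 < M)
    (hfM : ∀ t ∈ Finset.Icc 1 (K * K), ∀ i, ∀ x ∈ 𝒦, |f t i x| ≤ M)
    (j : Fin n) {w : Euc d} (hw : w ∈ 𝒦) {ε : ℝ} (hε : 0 ≤ ε) :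
    μ {ω | ε ≤ ∑ m ∈ Finset.range K, ∑ k ∈ Finset.range K,
      ⟪gradMean (F (m * K + k + 1) j) δ (A.x (m + 1) j ω) - A.g (m * K + k + 1) j ω,
        A.x (m + 1) j ω - w⟫} ≤
      ENNReal.ofReal (Real.exp (-ε ^ 2 / (2 * (K * K : ℕ) * (2 * (d / δ * M) * (2 * R)) ^ 2))) := by
  have hdiv : K * K / K = K := Nat.mul_div_cancel _ hK
  have hlt : ∀ t, t < 0 + K * K → t / K < K := fun t ht =>
    Nat.div_lt_of_lt_mul (by rwa [zero_add] at ht)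
  have hmem : ∀ t, t < 0 + K * K → ∀ ω, A.x (t / K + 1) j ω ∈ shrink 𝒦 r δ := fun t ht ω =>
    A.x_mem (hconv.smul _) hxin (m := t / K) (by rw [hdiv]; exact (hlt t ht).le) j ω
  have key := measure_noise_ge_le hd hu (j := j) (x := fun t => A.x (t / K + 1) j)
    (F := fun t => F t j) (fun t => hFc t j) (W := fun x => x - w) (by fun_prop) hδ hM
    (by positivity : 0 < 2 * R) (t₀ := 0) (Nat.mul_pos hK hK) (by omega)
    (fun t _ ht => (A.x_measurable hA (by rw [hdiv]; exact (hlt t ht).le) j).mono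
      (ℱ.mono (Nat.div_mul_le_self t K)) le_rfl)
    (fun t h1 h2 ω s => by
      have ht : t + 1 ∈ Finset.Icc 1 (K * K) := Finset.mem_Icc.2 ⟨by omega, by omega⟩
      have hmem := add_smul_mem_of_mem_shrink hconv hr hball hδ hδr (hmem t h2 ω)
        (norm_coe_unitSphere s).le
      rw [← hF _ ht j hmem]
      exact hfM _ ht j _ hmem)
    (fun t _ ht ω => by
      have e1 := mem_closedBall_zero_iff.1
        (hKR (shrink_subset hconv hr hball hδ hδr (hmem t ht ω)))
      have e2 := mem_closedBall_zero_iff.1 (hKR hw)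
      linarith [norm_sub_le (A.x (t / K + 1) j ω) w]) hε
  refine le_trans (le_of_eq ?_) key
  congr 1
  ext ω
  simp only [mem_ofPred_eq, zero_add]
  rw [sum_range_mul_eq (fun t => ⟪gradMean (F (t + 1) j) δ (A.x (t / K + 1) j ω) -
    gradEstimate (F (t + 1) j) δ (A.x (t / K + 1) j ω) (u (t + 1) j ω),
      A.x (t / K + 1) j ω - w⟫)]
  refine iff_of_eq (congrArg _ (Finset.sum_congr rfl fun m hm => Finset.sum_congr rfl
    fun k hk => ?_))
  have hk' := Finset.mem_range.1 hk
  have e : (m * K + k) / K = m := by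
    rw [mul_comm, Nat.mul_add_div hK, Nat.div_eq_of_lt hk', add_zero]
  rw [A.g_eq_gradEstimate hK hconv hr hball hδ hδr hxin hF (Finset.mem_range.1 hm) hk', e]

/-- With high probability all block gradients are small. -/
theorem measure_exists_gHat_gt_le (A : DBBCGRun E P f 𝒦 r δ xin 0 h K K (K * K) u)
    (hd : 0 < d) (hu : IsUniformSampling μ ℱ (K * K) u) (hA : A.IsCausal ℱ) (hK : 0 < K)
    (hconv : Convex ℝ 𝒦) (hr : 0 < r) (hball : Metric.closedBall 0 r ⊆ 𝒦) (hδ : 0 < δ)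
    (hδr : δ ≤ r) (hxin : xin ∈ shrink 𝒦 r δ) {F : ℕ → Fin n → Euc d → ℝ}
    (hF : ∀ t ∈ Finset.Icc 1 (K * K), ∀ j, EqOn (f t j) (F t j) 𝒦)
    (hFc : ∀ t j, Continuous (F t j)) {M : ℝ} (hM : 0 < M)
    (hfM : ∀ t ∈ Finset.Icc 1 (K * K), ∀ i, ∀ x ∈ 𝒦, |f t i x| ≤ M) {G : ℝ}
    (hfG : ∀ t ∈ Finset.Icc 1 (K * K), ∀ i, ∀ x ∈ 𝒦, ∀ y ∈ 𝒦,
      |f t i x - f t i y| ≤ G * ‖x - y‖) {γ : ℝ} (hγ : 0 < γ) (hγ1 : γ < 1 / 2) (hn : 0 < n)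
    (hKT : (K : ℝ) = √((K * K : ℕ) : ℝ)) :
    μ {ω | ¬ ∀ m < K, ∀ j, ‖A.gHat (m + 1) j ω‖ ≤
      √d * (2 * √d * (2 * (d / δ * M)) * √K * xi n (K * K) γ) + K * (d * G)} ≤
      ENNReal.ofReal γ := by
  set ξ := xi n (K * K) γ with hξ
  have hξ1 : 1 ≤ ξ := one_le_xi _ _ _
  have hdiv : K * K / K = K := Nat.mul_div_cancel _ hK
  have hd0 : (0 : ℝ) < d := by exact_mod_cast hd
  have hn0 : (0 : ℝ) < n := by exact_mod_cast hn
  have hK0 : (0 : ℝ) < K := by exact_mod_cast hK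
  -- The increments are bounded by `2 (d M / δ)`; the factor `2 √d` makes the tail exponent `-2 d
  -- ξ²`.
  set ε : ℝ := 2 * √d * (2 * (d / δ * M)) * √K * ξ with hε
  have hε0 : 0 ≤ ε := by positivity
  set w : Fin d → Bool → Euc d := fun l b =>
    (if b then (1 : ℝ) else -1) • EuclideanSpace.single l (1 : ℝ) with hw
  have hw1 : ∀ l b, ‖w l b‖ ≤ 1 := by
    intro l b; rw [hw]; cases b <;> simp
  set bad : Fin n × Fin K × Fin d × Bool → Set Ω := fun p =>
    {ω | ε ≤ ∑ k ∈ Finset.range K,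
      ⟪gradMean (F ((p.2.1 : ℕ) * K + k + 1) p.1) δ (A.x (p.2.1 + 1) p.1 ω) -
        A.g ((p.2.1 : ℕ) * K + k + 1) p.1 ω, w p.2.2.1 p.2.2.2⟫} with hbad
  have hsub : {ω | ¬ ∀ m < K, ∀ j, ‖A.gHat (m + 1) j ω‖ ≤ √d * ε + K * (d * G)} ⊆ ⋃ p, bad p := by
    intro ω hω
    by_contra hcon
    apply hω
    intro m hm j
    have hx := A.x_mem (hconv.smul _) hxin (m := m) (by omega) j ω
    have hsubK := shrink_subset hconv hr hball hδ hδr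
    have h1 : ‖∑ k ∈ Finset.range K, (gradMean (F (m * K + k + 1) j) δ (A.x (m + 1) j ω) -
        A.g (m * K + k + 1) j ω)‖ ≤ √d * ε := by
      refine EuclideanSpace.norm_le_sqrt_mul hε0 fun l b => ?_
      by_contra! hlt
      refine hcon (mem_iUnion.2 ⟨(j, ⟨m, hm⟩, l, b), ?_⟩)
      rw [sum_inner] at hlt
      exact hlt.le
    have h2 : ‖∑ k ∈ Finset.range K, gradMean (F (m * K + k + 1) j) δ (A.x (m + 1) j ω)‖ ≤
        K * (d * G) := by
      refine (norm_sum_le_of_le _ (n := fun _ => (d : ℝ) * G) fun k hk => ?_).trans (by simp)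
      have ht := round_mem hm (Finset.mem_range.1 hk)
      refine norm_gradMean_le hd (hFc _ j) hδ fun s => ?_
      have hmem := add_smul_mem_of_mem_shrink hconv hr hball hδ hδr hx (norm_coe_unitSphere s).le
      rw [← hF _ ht j hmem, ← hF _ ht j (hsubK hx)]
      refine (hfG _ ht j _ hmem _ (hsubK hx)).trans (le_of_eq ?_)
      rw [add_sub_cancel_left, norm_smul, norm_coe_unitSphere, Real.norm_eq_abs, abs_of_pos hδ,
        mul_one]
    have h3 : A.gHat (m + 1) j ω =
        ∑ k ∈ Finset.range K, gradMean (F (m * K + k + 1) j) δ (A.x (m + 1) j ω) -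
        ∑ k ∈ Finset.range K, (gradMean (F (m * K + k + 1) j) δ (A.x (m + 1) j ω) -
        A.g (m * K + k + 1) j ω) := by
      rw [A.gHat_eq_sum hK hm, Finset.sum_sub_distrib, sub_sub_cancel]
    rw [h3]
    refine (norm_sub_le _ _).trans ?_
    linarith
  have hone : ∀ p, μ (bad p) ≤ ENNReal.ofReal (γ / (2 * d * n * K)) := by
    intro p
    refine (A.measure_block_noise_ge_le hd hu hA hK hconv hr hball hδ hδr hxin hF hFc hM hfM
      p.2.1.2 p.1 (hw1 p.2.2.1 p.2.2.2) hε0).trans (ENNReal.ofReal_le_ofReal ?_)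
    have e : -ε ^ 2 / (2 * K * (2 * (d / δ * M)) ^ 2) = -(2 * d * ξ ^ 2) := by
      have h1 : ε ^ 2 = 4 * d * (2 * (d / δ * M)) ^ 2 * K * ξ ^ 2 := by
        rw [hε]
        simp only [mul_pow]
        rw [Real.sq_sqrt hd0.le, Real.sq_sqrt hK0.le]; ring
      rw [h1]
      have : (2 * (d / δ * M)) ≠ 0 := by positivity
      generalize 2 * (d / δ * M) = b at this
      field_simp
      ring
    rw [e]
    have hd1 : (1 : ℝ) ≤ d := by exact_mod_cast hd
    refine (exp_neg_mul_xi_sq_le hn hK hKT hγ hγ1 (by linarith : (1 : ℝ) / 2 ≤ 2 * d)).trans ?_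
    -- This pays for the `2 d` signed coordinates in the union over `2 d n K` events.
    have h2 : Real.exp (-(2 * d)) ≤ 1 / (2 * d) := by
      rw [Real.exp_neg, one_div]
      refine inv_anti₀ (by positivity) ?_
      linarith [Real.add_one_le_exp (2 * (d : ℝ))]
    calc _ ≤ 1 / (2 * d) * (γ / (n * K)) := by gcongr
      _ = _ := by field_simp
  calc _ ≤ μ (⋃ p, bad p) := measure_mono hsub
    _ ≤ ∑ p, μ (bad p) := measure_iUnion_fintype_le _ _
    _ ≤ ∑ _p : Fin n × Fin K × Fin d × Bool, ENNReal.ofReal (γ / (2 * d * n * K)) :=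
        Finset.sum_le_sum fun p _ => hone p
    _ = ENNReal.ofReal γ := by
        rw [Finset.sum_const, nsmul_eq_mul, ← ENNReal.ofReal_natCast,
          ← ENNReal.ofReal_mul (Nat.cast_nonneg _)]
        congr 1
        simp only [Finset.card_univ, Fintype.card_prod, Fintype.card_fin, Fintype.card_bool]
        push_cast
        field_simp

/-- With high probability the accumulated noise of every learner is small. -/
theorem measure_exists_noise_gt_le (A : DBBCGRun E P f 𝒦 r δ xin 0 h K K (K * K) u)
    (hd : 0 < d) (hu : IsUniformSampling μ ℱ (K * K) u) (hA : A.IsCausal ℱ) (hK : 0 < K)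
    (hconv : Convex ℝ 𝒦) (hr : 0 < r) (hball : Metric.closedBall 0 r ⊆ 𝒦) {R : ℝ} (hR : 0 < R)
    (hKR : 𝒦 ⊆ Metric.closedBall 0 R) (hδ : 0 < δ)
    (hδr : δ ≤ r) (hxin : xin ∈ shrink 𝒦 r δ) {F : ℕ → Fin n → Euc d → ℝ}
    (hF : ∀ t ∈ Finset.Icc 1 (K * K), ∀ j, EqOn (f t j) (F t j) 𝒦)
    (hFc : ∀ t j, Continuous (F t j)) {M : ℝ} (hM : 0 < M)
    (hfM : ∀ t ∈ Finset.Icc 1 (K * K), ∀ i, ∀ x ∈ 𝒦, |f t i x| ≤ M)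
    {γ : ℝ} (hγ : 0 < γ) (hγ1 : γ < 1 / 2) (hn : 0 < n)
    (hKT : (K : ℝ) = √((K * K : ℕ) : ℝ)) {w : Euc d} (hw : w ∈ 𝒦) :
    μ {ω | ¬ ∀ j, ∑ m ∈ Finset.range K, ∑ k ∈ Finset.range K,
      ⟪gradMean (F (m * K + k + 1) j) δ (A.x (m + 1) j ω) - A.g (m * K + k + 1) j ω,
        A.x (m + 1) j ω - w⟫ ≤ 4 * (d * M / δ) * R * K * xi n (K * K) γ} ≤
      ENNReal.ofReal γ := by
  set ξ := xi n (K * K) γ with hξ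
  have hξ1 : 1 ≤ ξ := one_le_xi _ _ _
  have hd0 : (0 : ℝ) < d := by exact_mod_cast hd
  have hn0 : (0 : ℝ) < n := by exact_mod_cast hn
  have hK0 : (0 : ℝ) < K := by exact_mod_cast hK
  -- The increment bound `2 (d M / δ) (2 R)` times `√(K * K) = K` times `ξ`, so the tail exponent is
  -- `-ξ² / 2`.
  set ε : ℝ := 4 * (d * M / δ) * R * K * ξ with hε
  have hε0 : 0 ≤ ε := by positivity
  set bad : Fin n → Set Ω := fun j =>
    {ω | ε ≤ ∑ m ∈ Finset.range K, ∑ k ∈ Finset.range K,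
      ⟪gradMean (F (m * K + k + 1) j) δ (A.x (m + 1) j ω) - A.g (m * K + k + 1) j ω,
        A.x (m + 1) j ω - w⟫} with hbad
  have hone : ∀ j, μ (bad j) ≤ ENNReal.ofReal (γ / n) := by
    intro j
    refine (A.measure_total_noise_ge_le hd hu hA hK hconv hr hball hR hKR hδ hδr hxin hF hFc hM hfM
      j hw hε0).trans (ENNReal.ofReal_le_ofReal ?_)
    have e : -ε ^ 2 / (2 * (K * K : ℕ) * (2 * (d / δ * M) * (2 * R)) ^ 2) = -(1 / 2 * ξ ^ 2) := by
      rw [hε]; push_cast; field_simp; ring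
    rw [e]
    refine (exp_neg_mul_xi_sq_le hn hK hKT hγ hγ1 (le_refl (1 / 2 : ℝ))).trans ?_
    have h2 : Real.exp (-(1 / 2)) ≤ 1 := Real.exp_le_one_iff.2 (by norm_num)
    have hK1 : (1 : ℝ) ≤ K := by exact_mod_cast hK
    calc _ ≤ 1 * (γ / (n * K)) := by gcongr
      _ ≤ 1 * (γ / n) := by
          gcongr
          nlinarith
      _ = _ := one_mul _
  calc _ ≤ μ (⋃ j, bad j) := by
        refine measure_mono fun ω hω => ?_
        by_contra hcon
        apply hω
        intro j
        by_contra! hlt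
        exact hcon (mem_iUnion.2 ⟨j, hlt.le⟩)
    _ ≤ ∑ j, μ (bad j) := measure_iUnion_fintype_le _ _
    _ ≤ ∑ _j : Fin n, ENNReal.ofReal (γ / n) := Finset.sum_le_sum fun j _ => hone j
    _ = ENNReal.ofReal γ := by
        rw [Finset.sum_const, nsmul_eq_mul, ← ENNReal.ofReal_natCast,
          ← ENNReal.ofReal_mul (Nat.cast_nonneg _)]
        congr 1
        simp only [Finset.card_univ, Fintype.card_fin]
        field_simp

end DBBCGRun

/-! ### Continuous extension, the comparator, and arithmetic of the parameters -/

/-- Functions which are Lipschitz on a set agree there with continuous functions. -/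
theorem exists_continuous_eqOn {n d T : ℕ} {𝒦 : Set (Euc d)} {G : ℝ}
    {f : ℕ → Fin n → Euc d → ℝ}
    (hf : ∀ t ∈ Finset.Icc 1 T, ∀ i, ∀ x ∈ 𝒦, ∀ y ∈ 𝒦, |f t i x - f t i y| ≤ G * ‖x - y‖) :
    ∃ F : ℕ → Fin n → Euc d → ℝ, (∀ t j, Continuous (F t j)) ∧
      ∀ t ∈ Finset.Icc 1 T, ∀ j, EqOn (f t j) (F t j) 𝒦 := by
  have hex : ∀ t j, ∃ F : Euc d → ℝ, Continuous F ∧ (t ∈ Finset.Icc 1 T → EqOn (f t j) F 𝒦) := by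
    intro t j
    by_cases ht : t ∈ Finset.Icc 1 T
    · have hL : LipschitzOnWith G.toNNReal (f t j) 𝒦 := by
        refine LipschitzOnWith.of_dist_le_mul fun x hx y hy => ?_
        rw [Real.dist_eq, dist_eq_norm]
        refine (hf t ht j x hx y hy).trans ?_
        gcongr
        exact Real.le_coe_toNNReal G
      obtain ⟨F, hF, hEq⟩ := hL.extend_real
      exact ⟨F, hF.continuous, fun _ => hEq⟩
    · exact ⟨fun _ => 0, continuous_const, fun h => absurd h ht⟩
  choose F h1 h2 using hex
  exact ⟨F, h1, fun t ht j => h2 t j ht⟩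

/-- The best fixed decision in hindsight is attained. -/
theorem exists_regret_eq {n d T : ℕ} {𝒦 : Set (Euc d)} (hcomp : IsCompact 𝒦)
    (hne : 𝒦.Nonempty) {f F : ℕ → Fin n → Euc d → ℝ} (hFc : ∀ t j, Continuous (F t j))
    (hF : ∀ t ∈ Finset.Icc 1 T, ∀ j, EqOn (f t j) (F t j) 𝒦) :
    ∃ x ∈ 𝒦, ∀ y : ℕ → Euc d, regret f 𝒦 T y =
      ∑ t ∈ Finset.Icc 1 T, ∑ j, f t j (y t) - ∑ t ∈ Finset.Icc 1 T, ∑ j, f t j x := by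
  have hcont : ContinuousOn (fun x => ∑ t ∈ Finset.Icc 1 T, ∑ j, f t j x) 𝒦 := by
    refine continuousOn_finsetSum _ fun t ht => continuousOn_finsetSum _ fun j _ => ?_
    exact (hFc t j).continuousOn.congr (hF t ht j)
  obtain ⟨x, hx, he⟩ := hcomp.exists_sInf_image_eq hne hcont
  exact ⟨x, hx, fun y => by rw [regret, he]⟩

/-- As `δ = c / √K`, the noise scale `√K / δ` equals `K / c`, the same order as the mean part `K d
G`. -/
theorem gHat_bound_arith {d K c M G ξ δ : ℝ} (hd : 0 < d) (hK : 0 < K) (hc : 0 < c) (hG : 0 ≤ G)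
    (hξ : 1 ≤ ξ) (hδ : δ = c / √K) :
    √d * (2 * √d * (2 * (d / δ * M)) * √K * ξ) + K * (d * G) ≤
      (4 * d * (d * M) / c + d * G) * ξ * K := by
  have hs : 0 < √K := Real.sqrt_pos.2 hK
  have hKs : K = √K * √K := (Real.mul_self_sqrt hK.le).symm
  have e : d / δ * M * √K = d * M / c * (√K * √K) := by
    rw [hδ]; field_simp
  have e1 : √d * (2 * √d * (2 * (d / δ * M)) * √K * ξ) = 4 * d * (d * M) / c * ξ * K := by
    calc _ = 4 * (√d * √d) * (d / δ * M * √K) * ξ := by ring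
      _ = _ := by rw [Real.mul_self_sqrt hd.le, e, ← hKs]; ring
  have e2 : K * (d * G) ≤ d * G * ξ * K := by
    calc K * (d * G) = d * G * 1 * K := by ring
      _ ≤ _ := by gcongr
  rw [e1, add_mul, add_mul]
  linarith

theorem natCast_mul_self_rpow (K : ℕ) (a : ℝ) :
    ((K * K : ℕ) : ℝ) ^ a = (K : ℝ) ^ (2 * a) := by
  rw [Nat.cast_mul, ← pow_two, ← Real.rpow_natCast, ← Real.rpow_mul (Nat.cast_nonneg K)]
  norm_num

theorem mul_natCast_mul_self_rpow_neg (K : ℕ) (c : ℝ) :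
    c * ((K * K : ℕ) : ℝ) ^ (-(1 / 4) : ℝ) = c / √(K : ℝ) := by
  rw [natCast_mul_self_rpow K, Real.sqrt_eq_rpow, div_eq_mul_inv c,
    ← Real.rpow_neg (Nat.cast_nonneg K)]
  norm_num

theorem natCast_mul_self_rpow_three_quarters (K : ℕ) :
    ((K * K : ℕ) : ℝ) ^ (3 / 4 : ℝ) = K * √(K : ℝ) := by
  rw [natCast_mul_self_rpow K, Real.sqrt_eq_rpow,
    ← Real.rpow_one_add' (Nat.cast_nonneg K) (by norm_num)]
  norm_num

theorem one_le_rpow_div_sqrt {n σ : ℝ} (hn : 1 ≤ n) (hσ : 0 < σ) (hσ1 : σ ≤ 1) :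
    1 ≤ n ^ (1 / 4 : ℝ) / √σ := by
  rw [le_div_iff₀ (Real.sqrt_pos.2 hσ), one_mul]
  exact (Real.sqrt_le_one.2 hσ1).trans (Real.one_le_rpow hn (by norm_num))

theorem rpow_div_sqrt_sq {n σ : ℝ} (hn : 0 ≤ n) (hσ : 0 ≤ σ) :
    (n ^ (1 / 4 : ℝ) / √σ) ^ 2 = √n / σ := by
  rw [div_pow, Real.sq_sqrt hσ, Real.sqrt_eq_rpow, ← Real.rpow_natCast, ← Real.rpow_mul hn]
  norm_num

theorem rpow_mul_rpow_neg_eq {n σ : ℝ} (hn : 0 ≤ n) (hσ : 0 ≤ σ) :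
    n ^ (5 / 4 : ℝ) * σ ^ (-(1 / 2) : ℝ) = n * (n ^ (1 / 4 : ℝ) / √σ) := by
  have e : n ^ (5 / 4 : ℝ) = n * n ^ (1 / 4 : ℝ) := by
    rw [← Real.rpow_one_add' hn (by norm_num)]; norm_num
  rw [e, Real.rpow_neg hσ, ← Real.sqrt_eq_rpow]
  ring

theorem DBBCGRun.y_mem {n d : ℕ} {Ω : Type*} {E : Fin n → Fin n → Prop}
    {P : Matrix (Fin n) (Fin n) ℝ} {f : ℕ → Fin n → Euc d → ℝ} {𝒦 : Set (Euc d)} {r δ : ℝ}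
    {xin : Euc d} {h : ℝ} {K : ℕ} {u : ℕ → Fin n → Ω → UnitSphere d}
    (A : DBBCGRun E P f 𝒦 r δ xin 0 h K K (K * K) u) (hK : 0 < K)
    (hconv : Convex ℝ 𝒦) (hr : 0 < r) (hball : Metric.closedBall 0 r ⊆ 𝒦) (hδ : 0 < δ)
    (hδr : δ ≤ r) (hxin : xin ∈ shrink 𝒦 r δ) {t : ℕ} (ht : t ∈ Finset.Icc 1 (K * K)) (i : Fin n)
    (ω : Ω) : A.y t i ω ∈ 𝒦 := by
  have ht' := Finset.mem_Icc.1 ht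
  have hm : (t - 1) / K < K := Nat.div_lt_of_lt_mul (by omega)
  have e : t = (t - 1) / K * K + (t - 1) % K + 1 := by
    rw [Nat.div_add_mod']; omega
  rw [e, A.y_eq_add hK hm (Nat.mod_lt _ hK)]
  exact add_smul_mem_of_mem_shrink hconv hr hball hδ hδr
    (A.x_mem (hconv.smul _) hxin (by rw [Nat.mul_div_cancel _ hK]; exact hm.le) i ω)
    (norm_coe_unitSphere _).le

end

/-! ### Assembly -/

theorem theorem8 (d : ℕ) (hd : 0 < d) (G M r R c : ℝ) (hr : 0 < r) (hR : 0 < R) (hc : 0 < c) :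
    ∃ C : ℝ, 0 < C ∧
      ∀ (𝒦 : Set (Euc d)), Convex ℝ 𝒦 → IsClosed 𝒦 →
        Metric.closedBall 0 r ⊆ 𝒦 → 𝒦 ⊆ Metric.closedBall 0 R →
      ∀ (n : ℕ) (E : Fin n → Fin n → Prop), (∀ i j, E i j → E j i) →
      ∀ (P : Matrix (Fin n) (Fin n) ℝ), IsGossipMatrix E P →
      ∀ (T K : ℕ), 0 < T → (K : ℝ) = √(T : ℝ) →
      ∀ (γ : ℝ), 0 < γ → γ < 1 / 2 →
      ∀ (δ h : ℝ), δ = c * (T : ℝ) ^ (-(1 / 4) : ℝ) → δ ≤ r →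
        h = (n : ℝ) ^ (1 / 4 : ℝ) * xi n T γ * d * M * (T : ℝ) ^ (3 / 4 : ℝ)
              / (√(1 - sigmaTwo P) * R) →
      ∀ (f : ℕ → Fin n → Euc d → ℝ),
        (∀ t ∈ Finset.Icc 1 T, ∀ i, ConvexOn ℝ 𝒦 (f t i)) →
        (∀ t ∈ Finset.Icc 1 T, ∀ i, ∀ x ∈ 𝒦, ∀ y ∈ 𝒦, |f t i x - f t i y| ≤ G * ‖x - y‖) →
        (∀ t ∈ Finset.Icc 1 T, ∀ i, ∀ x ∈ 𝒦, |f t i x| ≤ M) →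
      ∀ (xin : Euc d), xin ∈ shrink 𝒦 r δ →
      ∀ (Ω : Type*) [mΩ : MeasurableSpace Ω] (μ : MeasureTheory.Measure Ω)
        [MeasureTheory.IsProbabilityMeasure μ] (ℱ : MeasureTheory.Filtration ℕ mΩ)
        (u : ℕ → Fin n → Ω → UnitSphere d), IsUniformSampling μ ℱ T u →
      ∀ (A : DBBCGRun E P f 𝒦 r δ xin 0 h K K T u), A.IsCausal ℱ →
      ∀ i : Fin n,
        ENNReal.ofReal (1 - 2 * γ) ≤
          μ {ω | regret f 𝒦 T (fun t => A.y t i ω) ≤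
            C * ((n : ℝ) ^ (5 / 4 : ℝ) * (1 - sigmaTwo P) ^ (-(1 / 2) : ℝ)
              * (T : ℝ) ^ (3 / 4 : ℝ) * xi n T γ)} := by
  have hd0 : (0 : ℝ) < d := by exact_mod_cast hd
  -- The constant is chosen before any loss is given, so the signs of `G` and `M` are unknown;
  -- absolute values keep it nonnegative.
  set β₀ : ℝ := 4 * d * (d * |M|) / c + d * |G| with hβ₀
  have hβ₀0 : 0 ≤ β₀ := by positivity
  set C₀ : ℝ := 2 * |G| * (4 * R + 3 * β₀ * R / (2 * (d * |M|))) + 3 * |G| * c + |G| * c * R / r +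
    4 * (d * |M|) * R / c + β₀ * (4 * R + 3 * β₀ * R / (2 * (d * |M|))) + 4 * (d * |M|) * R with hC₀
  have hC₀0 : 0 ≤ C₀ := by positivity
  -- `C₀` vanishes when `G = M = 0`; the summand `1` keeps the constant positive.
  refine ⟨C₀ + 1, by positivity, ?_⟩
  intro 𝒦 hconv hcl hball hKR n E _ P hP T K hT hKT γ hγ hγ1 δ h hδ hδr hh f hfc hfG hfM xin hxin
    Ω mΩ μ hμ ℱ u hu A hA i
  have hTK : T = K * K := by
    have h1 : ((K * K : ℕ) : ℝ) = T := by
      rw [Nat.cast_mul, hKT, Real.mul_self_sqrt (Nat.cast_nonneg T)]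
    exact_mod_cast h1.symm
  subst hTK
  have hK : 0 < K := Nat.pos_of_mul_pos_right hT
  have hK0 : (0 : ℝ) < K := by exact_mod_cast hK
  have hn : 0 < n := Fin.pos i
  have hn0 : (0 : ℝ) < n := by exact_mod_cast hn
  have hn1 : (1 : ℝ) ≤ n := by exact_mod_cast hn
  have hσ : 0 < 1 - sigmaTwo P := by linarith [hP.sigmaTwo_lt_one]
  have hσ1 : 1 - sigmaTwo P ≤ 1 := by linarith [sigmaTwo_nonneg P]
  have hξ1 : 1 ≤ xi n (K * K) γ := one_le_xi _ _ _
  have hδK : δ = c / √K := hδ.trans (mul_natCast_mul_self_rpow_neg K c)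
  have hTpow := natCast_mul_self_rpow_three_quarters K
  have hδ0 : 0 < δ := by rw [hδK]; positivity
  have h0K : (0 : Euc d) ∈ 𝒦 := hball (by simp [hr.le])
  have hM0 : 0 ≤ M := (abs_nonneg _).trans
    (hfM 1 (Finset.mem_Icc.2 ⟨le_rfl, hT⟩) i 0 h0K)
  have hfG' : ∀ t ∈ Finset.Icc 1 (K * K), ∀ i, ∀ x ∈ 𝒦, ∀ y ∈ 𝒦,
      |f t i x - f t i y| ≤ |G| * ‖x - y‖ := fun t ht i x hx y hy =>
    (hfG t ht i x hx y hy).trans (by gcongr; exact le_abs_self G)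
  obtain ⟨F, hFc, hF⟩ := exists_continuous_eqOn hfG
  -- The comparator is fixed before any outcome `ω`, as the noise bound requires.
  obtain ⟨x, hx, hreg⟩ := exists_regret_eq
    (isCompact_of_isClosed_of_subset hcl hKR) ⟨0, h0K⟩ hFc hF
  set θ : ℝ := (n : ℝ) ^ (1 / 4 : ℝ) / √(1 - sigmaTwo P) with hθ
  have hθ1 : 1 ≤ θ := one_le_rpow_div_sqrt hn1 hσ hσ1
  have hθ2 : θ ^ 2 = √n / (1 - sigmaTwo P) := rpow_div_sqrt_sq hn0.le hσ.le
  have hrate : (n : ℝ) ^ (5 / 4 : ℝ) * (1 - sigmaTwo P) ^ (-(1 / 2) : ℝ) *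
      ((K * K : ℕ) : ℝ) ^ (3 / 4 : ℝ) * xi n (K * K) γ =
      n * (θ * (K * √K) * xi n (K * K) γ) := by
    rw [hTpow, rpow_mul_rpow_neg_eq hn0.le hσ.le]
    ring
  rw [hrate]
  have hrate0 : 0 ≤ n * (θ * (K * √K) * xi n (K * K) γ) := by positivity
  -- For `M = 0` the regularization `h` is zero and the stability argument breaks down, but then all
  -- losses vanish on `𝒦` and the regret is zero.
  rcases hM0.eq_or_lt with hMz | hMpos
  · have hall : {ω | regret f 𝒦 (K * K) (fun t => A.y t i ω) ≤
        (C₀ + 1) * (n * (θ * (K * √K) * xi n (K * K) γ))} = Set.univ := by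
      refine Set.eq_univ_of_forall fun ω => ?_
      have hz : ∀ t ∈ Finset.Icc 1 (K * K), ∀ j, ∀ y ∈ 𝒦, f t j y = 0 := fun t ht j y hy =>
        abs_nonpos_iff.1 ((hfM t ht j y hy).trans hMz.symm.le)
      have : regret f 𝒦 (K * K) (fun t => A.y t i ω) = 0 := by
        rw [hreg, ← Finset.sum_sub_distrib]
        refine Finset.sum_eq_zero fun t ht => ?_
        rw [← Finset.sum_sub_distrib]
        refine Finset.sum_eq_zero fun j _ => ?_
        rw [hz t ht j _ (A.y_mem hK hconv hr hball hδ0 hδr hxin ht i ω), hz t ht j x hx, sub_zero]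
      rw [Set.mem_ofPred_eq, this]
      positivity
    rw [hall, measure_univ]
    exact ENNReal.ofReal_le_one.2 (by linarith)
  have habsM : |M| = M := abs_of_pos hMpos
  have hhK : h = θ * xi n (K * K) γ * (d * M) * (K * √K) / R := by
    rw [hh, hTpow, hθ]; field_simp
  have hh0 : 0 < h := by rw [hhK]; positivity
  have hxi0 : 0 < xi n (K * K) γ := by linarith
  refine ofReal_one_sub_le_measure hγ.le ?_
    (A.measure_exists_gHat_gt_le hd hu hA hK hconv hr hball hδ0 hδr hxin hF hFc hMpos hfM
      hfG' hγ hγ1 hn hKT)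
    (A.measure_exists_noise_gt_le hd hu hA hK hconv hr hball hR hKR hδ0 hδr hxin hF hFc hMpos hfM
      hγ hγ1 hn hKT (shrink_subset hconv hr hball hδ0 hδr ⟨x, hx, rfl⟩))
  intro ω h1 h2
  have hgood := not_not.1 h1
  have hnoise := not_not.1 h2
  have hβ : √d * (2 * √d * (2 * (d / δ * M)) * √K * xi n (K * K) γ) + K * (d * |G|) ≤
      β₀ * xi n (K * K) γ * K := by
    rw [hβ₀, habsM]
    exact gHat_bound_arith hd0 hK0 hc (abs_nonneg G) hξ1 hδK
  have hdet := A.regret_le_of_bounds hd hR (abs_nonneg G) (by positivity) hK hh0 hP hconv hcl hr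
    hball hKR hδ0 hδr hxin hF hFc hfc hfG' ω (fun m hm j => (hgood m hm j).trans hβ) hx hnoise i rfl
  have harith := regret_bound_arith (abs_nonneg G) (by positivity : 0 < d * M) hr hR hc hβ₀0 hK0
    hξ1 hθ1 hδK hhK (D := 4 * R / √K + (√n * (β₀ * xi n (K * K) γ * K) / (1 - sigmaTwo P) +
      2 * (β₀ * xi n (K * K) γ * K)) / (2 * h)) (by rw [hθ2, div_mul_eq_mul_div])
  rw [Set.mem_ofPred_eq, hreg]
  refine hdet.trans ?_
  calc _ ≤ n * (C₀ * (θ * (K * √K) * xi n (K * K) γ)) := by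
        rw [hC₀, habsM]
        refine mul_le_mul_of_nonneg_left ?_ hn0.le
        linarith
    _ = C₀ * (n * (θ * (K * √K) * xi n (K * K) γ)) := by ring
    _ ≤ _ := by gcongr; linarith
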